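/- Clobber on a path (linear clobber) is played on a row of cells, each empty or holding a stone, $x$ (owned by Left) or $o$ (owned by Right). Left and Right alternate; a move takes one of the mover's stones that is adjacent to an opponent's stone, removes that opponent's stone and puts the moving stone in its place. Whoever cannot move loses. A position is in outcome class $\mathcal N$ if each player has a winning strategy when moving first, and in $\mathcal L$ if Left has a winning strategy when moving first and Right has none when moving first (so Left wins whoever starts). The parts of a position are its maximal blocks of consecutive stones; they are considered up to left-right reversal, and a position is identified with the sum (multiset) of its parts. The negative $-p$ of a part $p$ is obtained by changing the colour of every stone. Notation for parts. $a_n$ ($n$ even) is the alternating string $oxox\cdots$ with $n$ stones; $o_n$ ($n$ odd) is $oxo\cdots o$, alternating with $n$ stones; $oo_n$ is one $o$ followed by the alternating string $oxo\cdots$ with $n-1$ stones; $oo_noo$ ($n$ odd) is the alternating string $oxo\cdots o$ with $n-2$ stones, with one additional $o$ at each end. Standard form. A position is in standard form if none of the following rules, nor the negative of any of them (all parts on both sides negated), can be applied to its parts: $o,\ oo,\ ooo,\ ooxx,\ oxoxox\Rightarrow 0$; $p+(-p)\Rightarrow 0$ for any part $p$; $oxo,\ ooxox,\ ooxoxoo,\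 xxoxoxx\Rightarrow ox$; $oxoxoxoxo\Rightarrow ooxo$; $ooxoxx,\ oxoxoxoxoxox\Rightarrow oxox+ox$; $ooxoo\Rightarrow oox$; $ooxo\Rightarrow xxo+ox$. (Here $0$ is the position with no stones, and a rule with several parts separated by commas on the left applies to each of them separately.) Let $\mathcal O'=\{o_{2t+1}: t\ge 2,\ t\ne 4\}$, $o\mathcal O'=\{oo_{2t}: t\ge 5\}$, $o\mathcal Oo'=\{oox\}\cup\{oo_{2t+1}oo: t\ge 4\}$, $\mathcal I=\{a_2,a_4,oo_6\}$, $\mathcal A'=\{a_{2t}: t\ge 4,\ t\neq 6\}$, $o\mathcal A'=\{oo_{2t+1}: t\ge 3\}$, and $Q=\{o_5+a_2,\ o_7+a_4,\ o_{15}+a_4+a_2\}$. Let $\mathcal S$ be the set of positions in standard form that have at least one part and all of whose parts lie in $$\mathcal O'\cup o\mathcal O'\cup o\mathcal Oo'\cup\mathcal I\cup\{xxo\}\cup\{oo_8\}\cup\mathcal A'\cup o\mathcal A',$$ and that satisfy at least one of conditions 0, 1, 2 below. For such a position let $(a,b,c,d,e,f,y,z)$ be the numbers of its parts, counted with multiplicity,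 that lie in these eight sets, in this order. The conditions are: 0. $(y,z)\in\{(0,0),(1,0)\}$ and $a\ge c$, or $(y,z)=(0,1)$ and $a\ge c+1$; 1. $(y,z)=(0,0)$, $a\ge c+1$, and the position is not in $Q$; 2. $y=z=a=b=c=0$, $e\ge 1$, and either $d=0$ or $d+e\ge 3$. Let $\mathcal S_0,\mathcal S_1,\mathcal S_2$ be the sets of positions in $\mathcal S$ that satisfy conditions 0, 1, 2 respectively. Corollary. Every position in $\mathcal S_0$ is in $\mathcal L\cup\mathcal N$. Every position in $\mathcal S_1\cup\mathcal S_2$ is in $\mathcal L$. Every non-empty even-length alternating position, i.e. $(ox)^n$ with $n\ge 1$ up to reversal, other than $oxoxox$ (up to reversal), is in $\mathcal N$. -/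

import Mathlib

/-! Linear clobber (clobber on a path), outcome classes, and the sets of positions
`S0`, `S1`, `S2` of alternating linear clobber. -/

namespace Clobber

/-- The two stone colours. Left (Black) owns the stones `x`, Right (White) owns the stones `o`.
A colour also serves as the name of the player who owns it. -/
inductive Color where
  | x
  | o

/-- The opposite colour; also the opponent. -/
def Color.opp : Color → Color
  | .x => .o
  | .o => .x

/-- Player Left. -/
abbrev Left : Color := .x

/-- Player Right. -/
abbrev Right : Color := .o

/-- A position of linear clobber: a row of cells, each empty (`none`) or holding a stone. -/
abbrev Row := List (Option Color)

/-- `Move s g h`: the player `s` can move from `g` to `h`, by taking one of their stones that is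
adjacent to an opponent's stone, removing the latter and putting the former in its place. -/
inductive Move (s : Color) : Row → Row → Prop
  | clobberRight (l r : Row) :
      Move s (l ++ some s :: some s.opp :: r) (l ++ none :: some s :: r)
  | clobberLeft (l r : Row) :
      Move s (l ++ some s.opp :: some s :: r) (l ++ some s :: none :: r)

/-- `WinsFirst s g`: when the player `s` moves first on `g`, `s` has a winning strategy (under
normal play: whoever cannot move loses). That is, `s` has a move after which every reply of the
opponent leaves a position on which `s`, to move, has again a winning strategy. -/
inductive WinsFirst (s : Color) : Row → Prop
  | intro (g h : Row) (hmove : Move s g h) (hwin : ∀ k, Move s.opp h k → WinsFirst s k) :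
      WinsFirst s g

/-- The outcome class `𝓛`: Left, but not Right, wins when playing first
(so Left wins whoever starts). -/
def OutcomeL (g : Row) : Prop := WinsFirst Left g ∧ ¬ WinsFirst Right g

/-- The outcome class `𝓝`: whoever plays first wins. -/
def OutcomeN (g : Row) : Prop := WinsFirst Left g ∧ WinsFirst Right g

/-- A path of stones without empty cells, read from one of its ends. -/
abbrev Part := List Color

/-- Two strings of stones describe the same part if they are equal up to reversal. -/
def SamePart (p q : Part) : Prop := p = q ∨ p = q.reverse

/-- The parts (connected components) of a position, with multiplicity: the maximal blocks of
consecutive stones. -/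
def parts (g : Row) : Multiset Part :=
  (((g.splitOnP Option.isNone).map List.reduceOption).filter fun p => !p.isEmpty : List Part)

/-- Two collections of parts are the same up to reversal of individual parts. -/
def SameParts (G H : Multiset Part) : Prop := Multiset.Rel SamePart G H

/-- The alternating string of `n` stones that starts with colour `c`. -/
def alt (c : Color) : ℕ → Part
  | 0 => []
  | n + 1 => c :: alt c.opp n

/-- `a n` is `oxox⋯` with `n` stones, used for even `n`, e.g. `a 4 = oxox`. -/
def a (n : ℕ) : Part := alt .o n

/-- `o n` is `oxo⋯` with `n` stones, used for odd `n`, e.g. `o 5 = oxoxo`. -/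
def o (n : ℕ) : Part := alt .o n

/-- `oo n` is `o` followed by an alternating string that starts with `o`, with `n ≥ 1` stones in
all, e.g. `oo 4 = ooxo` and `oo 5 = ooxox`. -/
def oo (n : ℕ) : Part := .o :: alt .o (n - 1)

/-- `ooEndoo n` is `o⋯o` alternating with one extra `o` at each end, with `n` stones in all
(odd `n ≥ 3`), e.g. `ooEndoo 5 = ooxoo`. -/
def ooEndoo (n : ℕ) : Part := .o :: (alt .o (n - 2) ++ [.o])

/-- `ooEndxx n` is `o⋯x` alternating with an extra `o` at the front and an extra `x` at the back,
with `n` stones in all (even `n ≥ 4`), e.g. `ooEndxx 6 = ooxoxx`. -/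
def ooEndxx (n : ℕ) : Part := .o :: (alt .o (n - 2) ++ [.x])

/-- The part `xxo`. -/
def xxo : Part := [.x, .x, .o]

/-- The negative of a part: change the colour of each stone. -/
def negPart (p : Part) : Part := p.map Color.opp

/-! ### Standard form -/

/-- The replacement rules of the standard-form algorithm. -/
inductive Rule : Multiset Part → Multiset Part → Prop
  | alpha_o : Rule {[.o]} 0
  | alpha_oo : Rule {[.o, .o]} 0
  | alpha_ooo : Rule {[.o, .o, .o]} 0
  | alpha_ooxx : Rule {ooEndxx 4} 0
  | alpha_a6 : Rule {a 6} 0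
  | beta (p : Part) : Rule {p, negPart p} 0
  | gamma_o3 : Rule {o 3} {a 2}
  | gamma_oo5 : Rule {oo 5} {a 2}
  | gamma_oo7oo : Rule {ooEndoo 7} {a 2}
  | gamma_xx7xx : Rule {negPart (ooEndoo 7)} {a 2}
  | delta : Rule {o 9} {oo 4}
  | epsilon_oo6xx : Rule {ooEndxx 6} {a 4, a 2}
  | epsilon_a12 : Rule {a 12} {a 4, a 2}
  | zeta : Rule {ooEndoo 5} {oo 3}
  | eta : Rule {oo 4} {xxo, a 2}
  | neg {G H : Multiset Part} : Rule G H → Rule (G.map negPart) (H.map negPart)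

/-- `Reduces G H`: some rule turns the collection of parts `G` into `H`, by replacing parts that
match the left-hand side (up to reversal) by the right-hand side. -/
def Reduces (G H : Multiset Part) : Prop :=
  ∃ L R M C : Multiset Part, Rule L R ∧ SameParts M L ∧ G = M + C ∧ H = R + C

/-- A position is in standard form if no rule applies to its parts. -/
def IsStandardForm (g : Row) : Prop := ∀ H, ¬ Reduces (parts g) H

/-! ### The sets of parts, the count vector, and the sets of positions -/

/-- The parts that coincide up to reversal with some string in `X`. -/
def upToReversal (X : Set Part) : Set Part := {p | ∃ q ∈ X, SamePart p q}

/-- `{a2, a4, a6, …}`, the non-empty even-length alternating parts. -/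
def setA : Set Part := upToReversal {p | ∃ t, 1 ≤ t ∧ p = a (2 * t)}

/-- `{a8, a10, a14, a16, …}` -/
def setA' : Set Part := upToReversal {p | ∃ t, 4 ≤ t ∧ t ≠ 6 ∧ p = a (2 * t)}

/-- `{o5, o7, o11, o13, …}` -/
def setO' : Set Part := upToReversal {p | ∃ t, 2 ≤ t ∧ t ≠ 4 ∧ p = o (2 * t + 1)}

/-- `{oo10, oo12, …}` -/
def setoO' : Set Part := upToReversal {p | ∃ t, 5 ≤ t ∧ p = oo (2 * t)}

/-- `{oo7, oo9, …}` -/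
def setoA' : Set Part := upToReversal {p | ∃ t, 3 ≤ t ∧ p = oo (2 * t + 1)}

/-- `{oo3, oo9oo, oo11oo, …}` -/
def setoOo' : Set Part :=
  upToReversal {p | p = oo 3 ∨ ∃ t, 4 ≤ t ∧ p = ooEndoo (2 * t + 1)}

/-- `{a2, a4, oo6}` -/
def setI : Set Part := upToReversal {a 2, a 4, oo 6}

/-- `{xxo}` -/
def setXxo : Set Part := upToReversal {xxo}

/-- `{oo8}` -/
def setOo8 : Set Part := upToReversal {oo 8}

/-- The set of parts from which the positions under study are made. -/
def setK : Set Part :=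
  setO' ∪ setoO' ∪ setoOo' ∪ setI ∪ setXxo ∪ setOo8 ∪ setA' ∪ setoA'

open Classical in
/-- The number of parts of `g`, with multiplicity, that lie in `X`. -/
noncomputable def numParts (X : Set Part) (g : Row) : ℕ := (parts g).countP (· ∈ X)

/-- `{o5 + a2, o7 + a4, o15 + a4 + a2}` -/
def Q (g : Row) : Prop :=
  SameParts (parts g) {o 5, a 2} ∨ SameParts (parts g) {o 7, a 4} ∨
    SameParts (parts g) {o 15, a 4, a 2}

/-- The positions that have a count vector and at least one part: they are in standard form,
and all their parts are in `setK`. The entries `a, b, c, d, e, f, y, z` of the count vector are the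
numbers of parts in `setO'`, `setoO'`, `setoOo'`, `setI`, `setXxo`, `setOo8`, `setA'`, `setoA'`. -/
def Admissible (g : Row) : Prop :=
  IsStandardForm g ∧ (∀ p ∈ parts g, p ∈ setK) ∧ parts g ≠ 0

/-- In the count vector `(a, b, c, d, e, f, y, z)`: `(y, z) = (1, 0)` and `a ≥ c`, or
`(y, z) = (0, 0)` and `a ≥ c`, or `(y, z) = (0, 1)` and `a ≥ c + 1`. -/
def S0 (g : Row) : Prop :=
  Admissible g ∧
    ((numParts setA' g = 1 ∧ numParts setoA' g = 0 ∧ numParts setoOo' g ≤ numParts setO' g) ∨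
     (numParts setA' g = 0 ∧ numParts setoA' g = 0 ∧ numParts setoOo' g ≤ numParts setO' g) ∨
     (numParts setA' g = 0 ∧ numParts setoA' g = 1 ∧ numParts setoOo' g + 1 ≤ numParts setO' g))

/-- In the count vector: `(y, z) = (0, 0)` and `a ≥ c + 1`, and the position is not in `Q`. -/
def S1 (g : Row) : Prop :=
  Admissible g ∧ numParts setA' g = 0 ∧ numParts setoA' g = 0 ∧
    numParts setoOo' g + 1 ≤ numParts setO' g ∧ ¬ Q g

/-- In the count vector: `(y, z, a, b, c) = (0, 0, 0, 0, 0)`, `e ≥ 1`, and `d = 0` or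
`d + e ≥ 3`. -/
def S2 (g : Row) : Prop :=
  Admissible g ∧ numParts setA' g = 0 ∧ numParts setoA' g = 0 ∧ numParts setO' g = 0 ∧
    numParts setoO' g = 0 ∧ numParts setoOo' g = 0 ∧ 1 ≤ numParts setXxo g ∧
    (numParts setI g = 0 ∨ 3 ≤ numParts setI g + numParts setXxo g)

end Clobber

namespace Clobber

/-! ### Moves on collections of parts -/

instance : DecidableEq Color := fun p q => by
  cases p <;> cases q <;> first | exact isTrue rfl | exact isFalse (by simp)

@[simp] theorem Color.opp_opp (s : Color) : s.opp.opp = s := by cases s <;> rfl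

@[simp] theorem Color.opp_x : Color.opp .x = .o := rfl

@[simp] theorem Color.opp_o : Color.opp .o = .x := rfl

/-- `PartMove s p q r`: the player `s` can move in the part `p` so that the parts `q` and `r`
(which may be empty) remain. -/
inductive PartMove (s : Color) : Part → Part → Part → Prop
  | clobberRight (l r : Part) : PartMove s (l ++ s :: s.opp :: r) l (s :: r)
  | clobberLeft (l r : Part) : PartMove s (l ++ s.opp :: s :: r) (l ++ [s]) r

/-- Moves on collections of parts, among which empty ones are allowed. -/
inductive SumMove (s : Color) : Multiset Part → Multiset Part → Prop
  | intro (p q r : Part) (C : Multiset Part) (h : PartMove s p q r) :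
      SumMove s (p ::ₘ C) (q ::ₘ r ::ₘ C)

/-- The player `s` wins when moving first on a collection of parts. -/
inductive Wins (s : Color) : Multiset Part → Prop
  | intro (M N : Multiset Part) (hmove : SumMove s M N)
      (hwin : ∀ K, SumMove s.opp N K → Wins s K) : Wins s M

/-- The blocks of stones between consecutive empty cells; unlike `parts`, this includes the empty
blocks. -/
def blocks (g : Row) : Multiset Part :=
  ((g.splitOnP Option.isNone).map List.reduceOption : List Part)

theorem blocks_append (g h : Row) : blocks (g ++ none :: h) = blocks g + blocks h := by
  rw [blocks, List.splitOnP_append_cons _ _ rfl, List.map_append]; rfl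

theorem reduceOption_map_some (p : Part) : List.reduceOption (p.map some) = p := by
  simp [List.reduceOption]

theorem blocks_map_some (p : Part) : blocks (p.map some) = {p} := by
  rw [blocks, List.splitOnP_eq_singleton (by simp)]
  simp [reduceOption_map_some]

theorem row_first_block (g : Row) :
    (∃ p : Part, g = p.map some) ∨ ∃ (p : Part) (h : Row), g = p.map some ++ none :: h := by
  induction g with
  | nil => exact .inl ⟨[], rfl⟩
  | cons c g ih =>
    cases c with
    | none => exact .inr ⟨[], g, rfl⟩
    | some c =>
      rcases ih with ⟨p, rfl⟩ | ⟨p, h, rfl⟩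
      · exact .inl ⟨c :: p, rfl⟩
      · exact .inr ⟨c :: p, h, rfl⟩

theorem blocks_append_right (r : Row) :
    ∃ (q : Part) (R : Multiset Part), ∀ t, blocks (t ++ r) = blocks (t ++ q.map some) + R := by
  rcases row_first_block r with ⟨p, rfl⟩ | ⟨p, h, rfl⟩
  · exact ⟨p, 0, by simp⟩
  · exact ⟨p, blocks h, fun t => by rw [← List.append_assoc, blocks_append]⟩

theorem blocks_append_left (l : Row) :
    ∃ (p : Part) (L : Multiset Part), ∀ t, blocks (l ++ t) = L + blocks (p.map some ++ t) := by
  rcases row_first_block l.reverse with ⟨p, h⟩ | ⟨p, k, h⟩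
  · refine ⟨p.reverse, 0, fun t => ?_⟩
    rw [← List.reverse_reverse l, h, List.map_reverse, zero_add]
  · refine ⟨p.reverse, blocks k.reverse, fun t => ?_⟩
    rw [← List.reverse_reverse l, h, List.map_reverse, ← blocks_append]
    simp

theorem exists_context_of_mem_blocks {p : Part} (g : Row) (hp : p ∈ blocks g) :
    ∃ (l r : Row) (C : Multiset Part), g = l ++ p.map some ++ r ∧
      ∀ t, blocks (l ++ t ++ r) = blocks t + C := by
  induction hn : g.length using Nat.strong_induction_on generalizing g with | _ n ih => ?_
  rcases row_first_block g with ⟨q, rfl⟩ | ⟨q, h, rfl⟩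
  · rw [blocks_map_some, Multiset.mem_singleton] at hp
    subst hp
    exact ⟨[], [], 0, by simp, by simp⟩
  · rw [blocks_append, blocks_map_some, Multiset.mem_add, Multiset.mem_singleton] at hp
    rcases hp with rfl | hp
    · exact ⟨[], none :: h, blocks h, by simp, fun t => by simp [blocks_append]⟩
    · obtain ⟨l, r, C, rfl, hC⟩ := ih h.length (by simp at hn; omega) h hp rfl
      refine ⟨q.map some ++ none :: l, r, {q} + C, by simp, fun t => ?_⟩
      have := hC t
      simp only [List.append_assoc, List.cons_append] at this ⊢
      rw [blocks_append, blocks_map_some, this]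
      abel

theorem Move.context {s : Color} {g h : Row} (l r : Row) (H : Move s g h) :
    Move s (l ++ g ++ r) (l ++ h ++ r) := by
  cases H with
  | clobberRight a b => simpa using Move.clobberRight (s := s) (l ++ a) (b ++ r)
  | clobberLeft a b => simpa using Move.clobberLeft (s := s) (l ++ a) (b ++ r)

theorem PartMove.exists_move {s : Color} {p q r : Part} (H : PartMove s p q r) :
    ∃ h, Move s (p.map some) h ∧ blocks h = q ::ₘ {r} := by
  cases H with
  | clobberRight _ b =>
    refine ⟨q.map some ++ none :: (s :: b : Part).map some, ?_, ?_⟩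
    · simpa using Move.clobberRight (s := s) (q.map some) (b.map some)
    · rw [blocks_append, blocks_map_some, blocks_map_some]; rfl
  | clobberLeft a _ =>
    refine ⟨(a ++ [s] : Part).map some ++ none :: r.map some, ?_, ?_⟩
    · simpa using Move.clobberLeft (s := s) (a.map some) (r.map some)
    · rw [blocks_append, blocks_map_some, blocks_map_some]; rfl

theorem SumMove.exists_move {s : Color} {g : Row} {N : Multiset Part}
    (H : SumMove s (blocks g) N) : ∃ h, Move s g h ∧ blocks h = N := by
  generalize hM : blocks g = M at H
  cases H with
  | intro p q r C hp =>
    obtain ⟨l, t, D, rfl, hD⟩ :=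
      exists_context_of_mem_blocks g (p := p) (by rw [hM]; exact Multiset.mem_cons_self _ _)
    obtain ⟨h, hm, hb⟩ := hp.exists_move
    refine ⟨l ++ h ++ t, hm.context l t, ?_⟩
    rw [hD, blocks_map_some, Multiset.singleton_add, Multiset.cons_inj_right] at hM
    rw [hD, hb, hM]
    simp

theorem Move.sumMove {s : Color} {g h : Row} (H : Move s g h) :
    SumMove s (blocks g) (blocks h) := by
  cases H with
  | clobberRight l r =>
    obtain ⟨p, L, hL⟩ := blocks_append_left l
    obtain ⟨q, R, hR⟩ := blocks_append_right r
    have h1 : blocks (l ++ some s :: some s.opp :: r) = (p ++ s :: s.opp :: q) ::ₘ (L + R) := by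
      have := hR (p.map some ++ [some s, some s.opp])
      have h2 := blocks_map_some (p ++ s :: s.opp :: q)
      simp only [List.append_assoc, List.cons_append, List.nil_append, List.map_append,
        List.map_cons] at this h2
      rw [hL, this, h2, ← Multiset.singleton_add]
      abel
    have h2 : blocks (l ++ none :: some s :: r) = p ::ₘ (s :: q) ::ₘ (L + R) := by
      have := hR (p.map some ++ [none, some s])
      have h2 := blocks_map_some (s :: q)
      simp only [List.append_assoc, List.cons_append, List.nil_append, List.map_cons] at this h2
      rw [hL, this, blocks_append, h2, blocks_map_some, ← Multiset.singleton_add,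
        ← Multiset.singleton_add]
      abel
    rw [h1, h2]
    exact .intro _ _ _ _ (.clobberRight _ _)
  | clobberLeft l r =>
    obtain ⟨p, L, hL⟩ := blocks_append_left l
    obtain ⟨q, R, hR⟩ := blocks_append_right r
    have h1 : blocks (l ++ some s.opp :: some s :: r) = (p ++ s.opp :: s :: q) ::ₘ (L + R) := by
      have := hR (p.map some ++ [some s.opp, some s])
      have h2 := blocks_map_some (p ++ s.opp :: s :: q)
      simp only [List.append_assoc, List.cons_append, List.nil_append, List.map_append,
        List.map_cons] at this h2
      rw [hL, this, h2, ← Multiset.singleton_add]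
      abel
    have h2 : blocks (l ++ some s :: none :: r) = (p ++ [s]) ::ₘ q ::ₘ (L + R) := by
      have := hR (p.map some ++ [some s, none])
      have h2 := blocks_map_some q
      have h3 := blocks_append ((p ++ [s]).map some) (q.map some)
      simp only [List.append_assoc, List.cons_append, List.nil_append, List.map_append,
        List.map_cons, List.map_nil] at this h2 h3
      have h4 := blocks_map_some (p ++ [s])
      simp only [List.map_append, List.map_cons, List.map_nil] at h4
      rw [hL, this, h3, h2, h4, ← Multiset.singleton_add, ← Multiset.singleton_add]
      abel
    rw [h1, h2]
    exact .intro _ _ _ _ (.clobberLeft _ _)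

theorem winsFirst_iff (s : Color) (g : Row) : WinsFirst s g ↔ Wins s (blocks g) := by
  constructor
  · intro H
    induction H with
    | intro g h hmove _ ih =>
      refine .intro _ _ hmove.sumMove fun K hK => ?_
      obtain ⟨k, hk, rfl⟩ := hK.exists_move
      exact ih k hk
  · intro H
    generalize hM : blocks g = M at H
    induction H generalizing g with
    | intro M N hmove _ ih =>
      subst hM
      obtain ⟨h, hm, rfl⟩ := hmove.exists_move
      exact .intro _ h hm fun k hk => ih _ hk.sumMove k rfl

/-! ### Sums of positions -/

theorem opp_rec {P : Color → Prop} (s : Color) (h : P s) (h' : P s.opp) (t : Color) : P t := by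
  cases s <;> cases t <;> assumption

/-- The total number of stones. -/
def stones (M : Multiset Part) : ℕ := (M.map List.length).sum

@[simp] theorem stones_cons (p : Part) (M : Multiset Part) :
    stones (p ::ₘ M) = p.length + stones M := by simp [stones]

@[simp] theorem stones_add (M N : Multiset Part) : stones (M + N) = stones M + stones N := by
  simp [stones]

theorem SumMove.stones_lt {s : Color} {M N : Multiset Part} (H : SumMove s M N) :
    stones N < stones M := by
  cases H with
  | intro p q r C h => cases h <;> simp <;> omega

theorem sumMove_add {s : Color} {M N K : Multiset Part} :
    SumMove s (M + N) K ↔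
      (∃ M', SumMove s M M' ∧ K = M' + N) ∨ ∃ N', SumMove s N N' ∧ K = M + N' := by
  constructor
  · intro H
    generalize hS : M + N = S at H
    cases H with
    | intro p q r C h =>
      have hp : p ∈ M + N := by rw [hS]; exact Multiset.mem_cons_self _ _
      rcases Multiset.mem_add.1 hp with hp | hp
      · obtain ⟨M, rfl⟩ := Multiset.exists_cons_of_mem hp
        rw [Multiset.cons_add, Multiset.cons_inj_right] at hS
        subst hS
        exact .inl ⟨_, .intro _ _ _ _ h, by simp⟩
      · obtain ⟨N, rfl⟩ := Multiset.exists_cons_of_mem hp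
        rw [Multiset.add_cons, Multiset.cons_inj_right] at hS
        subst hS
        exact .inr ⟨_, .intro _ _ _ _ h, by simp⟩
  · rintro (⟨M', h, rfl⟩ | ⟨N', h, rfl⟩)
    · cases h with
      | intro p q r C h => simpa using SumMove.intro p q r (C + N) h
    · cases h with
      | intro p q r C h => simpa using SumMove.intro p q r (M + C) h

theorem Wins.exists_reply {s : Color} {M : Multiset Part} (H : Wins s M) :
    ¬ ∀ N, SumMove s M N → Wins s.opp N := by
  induction H with
  | intro M N hmove hwin ih =>
    intro hall
    cases hall N hmove with
    | intro _ K hmove' hwin' =>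
      rw [Color.opp_opp] at hwin'
      exact ih K hmove' hwin'

theorem not_wins_iff {s : Color} {M : Multiset Part} :
    ¬ Wins s M ↔ ∀ N, SumMove s M N → Wins s.opp N := by
  refine ⟨fun H N hN => ?_, fun H h => h.exists_reply H⟩
  by_contra hW
  refine H (.intro _ N hN fun K hK => ?_)
  by_contra hK'
  refine hW (.intro _ K hK ?_)
  rw [Color.opp_opp]
  exact not_wins_iff.1 hK'
termination_by stones M
decreasing_by
  have h1 := SumMove.stones_lt (by assumption : SumMove s M N)
  have h2 := SumMove.stones_lt (by assumption : SumMove s.opp N K)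
  omega

theorem wins_iff {s : Color} {M : Multiset Part} :
    Wins s M ↔ ∃ N, SumMove s M N ∧ ¬ Wins s.opp N := by
  rw [← not_iff_not, not_wins_iff]
  push Not
  rfl

theorem not_wins_add {s : Color} {M N : Multiset Part} (hM : ¬ Wins s M) (hN : ¬ Wins s N) :
    ¬ Wins s (M + N) := by
  rw [not_wins_iff]
  intro K hK
  rw [wins_iff]
  rcases sumMove_add.1 hK with ⟨M', h, rfl⟩ | ⟨N', h, rfl⟩
  · obtain ⟨M'', h', hw⟩ := wins_iff.1 (not_wins_iff.1 hM M' h)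
    rw [Color.opp_opp] at hw ⊢
    have h1 := h.stones_lt
    have h2 := h'.stones_lt
    exact ⟨M'' + N, sumMove_add.2 (.inl ⟨_, h', rfl⟩), not_wins_add hw hN⟩
  · obtain ⟨N'', h', hw⟩ := wins_iff.1 (not_wins_iff.1 hN N' h)
    rw [Color.opp_opp] at hw ⊢
    have h1 := h.stones_lt
    have h2 := h'.stones_lt
    exact ⟨M + N'', sumMove_add.2 (.inr ⟨_, h', rfl⟩), not_wins_add hM hw⟩
termination_by stones M + stones N

mutual

theorem not_wins_of_add {s : Color} {M Z : Multiset Part} (h : ¬ Wins s (M + Z))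
    (hZ : ¬ Wins s.opp Z) : ¬ Wins s M := by
  rw [not_wins_iff]
  intro M' hM'
  have := hM'.stones_lt
  exact wins_of_add (not_wins_iff.1 h _ (sumMove_add.2 (.inl ⟨_, hM', rfl⟩))) hZ
termination_by stones M + stones Z

theorem wins_of_add {s : Color} {M Z : Multiset Part} (h : Wins s (M + Z)) (hZ : ¬ Wins s Z) :
    Wins s M := by
  obtain ⟨K, hK, hw⟩ := wins_iff.1 h
  rcases sumMove_add.1 hK with ⟨M', h', rfl⟩ | ⟨Z', h', rfl⟩
  · have := h'.stones_lt
    exact wins_iff.2 ⟨M', h', not_wins_of_add hw (by rwa [Color.opp_opp])⟩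
  · obtain ⟨Z'', h'', hw''⟩ := wins_iff.1 (not_wins_iff.1 hZ _ h')
    rw [Color.opp_opp] at hw''
    have h1 := h'.stones_lt
    have h2 := h''.stones_lt
    have h3 := not_wins_iff.1 hw _ (sumMove_add.2 (.inr ⟨_, h'', rfl⟩))
    rw [Color.opp_opp] at h3
    exact wins_of_add h3 hw''
termination_by stones M + stones Z

end

/-! ### Negatives and reversals -/

/-- The negative of a collection of parts. -/
def negParts (M : Multiset Part) : Multiset Part := M.map negPart

@[simp] theorem negPart_negPart (p : Part) : negPart (negPart p) = p := by
  simp [negPart, Function.comp_def]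

@[simp] theorem negParts_negParts (M : Multiset Part) : negParts (negParts M) = M := by
  simp [negParts]

@[simp] theorem negParts_add (M N : Multiset Part) :
    negParts (M + N) = negParts M + negParts N := by simp [negParts]

@[simp] theorem negParts_zero : negParts 0 = 0 := rfl

@[simp] theorem negParts_cons (p : Part) (M : Multiset Part) :
    negParts (p ::ₘ M) = negPart p ::ₘ negParts M := by simp [negParts]

theorem PartMove.neg {s : Color} {p q r : Part} (H : PartMove s p q r) :
    PartMove s.opp (negPart p) (negPart q) (negPart r) := by
  cases H with
  | clobberRight _ r =>
    simpa [negPart] using PartMove.clobberRight (s := s.opp) (negPart q) (negPart r)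
  | clobberLeft l _ =>
    simpa [negPart] using PartMove.clobberLeft (s := s.opp) (negPart l) (negPart r)

theorem SumMove.neg {s : Color} {M N : Multiset Part} (H : SumMove s M N) :
    SumMove s.opp (negParts M) (negParts N) := by
  cases H with
  | intro p q r C h => simpa using SumMove.intro _ _ _ (negParts C) h.neg

theorem sumMove_negParts {s : Color} {M N : Multiset Part} (H : SumMove s (negParts M) N) :
    ∃ K, SumMove s.opp M K ∧ N = negParts K :=
  ⟨negParts N, by simpa using H.neg, by simp⟩

theorem Wins.neg {s : Color} {M : Multiset Part} (H : Wins s M) : Wins s.opp (negParts M) := by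
  induction H with
  | intro M N hmove _ ih =>
    refine .intro _ _ hmove.neg fun K hK => ?_
    obtain ⟨J, hJ, rfl⟩ := sumMove_negParts hK
    rw [Color.opp_opp] at hJ
    exact ih J hJ

theorem wins_negParts {s : Color} {M : Multiset Part} :
    Wins s (negParts M) ↔ Wins s.opp M :=
  ⟨fun h => by simpa using h.neg, fun h => by simpa using h.neg⟩

theorem not_wins_add_neg (s : Color) (M : Multiset Part) : ¬ Wins s (M + negParts M) := by
  rw [not_wins_iff]
  intro K hK
  rcases sumMove_add.1 hK with ⟨M', h, rfl⟩ | ⟨N', h, rfl⟩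
  · have := h.stones_lt
    exact wins_iff.2 ⟨M' + negParts M', sumMove_add.2 (.inr ⟨_, h.neg, rfl⟩),
      not_wins_add_neg _ M'⟩
  · obtain ⟨M', h', rfl⟩ := sumMove_negParts h
    have := h'.stones_lt
    exact wins_iff.2 ⟨M' + negParts M', sumMove_add.2 (.inl ⟨_, h', rfl⟩),
      not_wins_add_neg _ M'⟩
termination_by stones M

theorem PartMove.reverse {s : Color} {p q r : Part} (H : PartMove s p q r) :
    PartMove s p.reverse r.reverse q.reverse := by
  cases H with
  | clobberRight _ r => simpa using PartMove.clobberLeft (s := s) r.reverse q.reverse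
  | clobberLeft l _ => simpa using PartMove.clobberRight (s := s) r.reverse l.reverse

/-! ### The group of values -/

/-- Equality of values: the difference is a second-player win. -/
def valueCon : AddCon (Multiset Part) where
  r M N := ∀ s, ¬ Wins s (M + negParts N)
  iseqv :=
    { refl := fun M s => not_wins_add_neg s M
      symm := fun {M N} h s => by
        have : N + negParts M = negParts (M + negParts N) := by simp [add_comm]
        rw [this, wins_negParts]
        exact h _
      trans := fun {M N K} h1 h2 s => by
        refine not_wins_of_add (Z := N + negParts N) ?_ (not_wins_add_neg _ N)
        have := not_wins_add (h1 s) (h2 s)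
        rwa [show M + negParts N + (N + negParts K) = M + negParts K + (N + negParts N) by
          abel] at this }
  add' := fun {M N K L} h1 h2 s => by
    have := not_wins_add (h1 s) (h2 s)
    rwa [show M + negParts N + (K + negParts L) = M + K + negParts (N + L) by
      rw [negParts_add]; abel] at this

/-- Game values of collections of parts. -/
abbrev Value : Type := valueCon.Quotient

/-- The value of a collection of parts. -/
def value : Multiset Part →+ Value := valueCon.mk'

theorem value_eq_iff {M N : Multiset Part} :
    value M = value N ↔ ∀ s, ¬ Wins s (M + negParts N) := valueCon.eq

theorem exists_value (x : Value) : ∃ M, value M = x := AddCon.mk'_surjective x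

theorem value_negParts_congr {M N : Multiset Part} (h : value M = value N) :
    value (negParts M) = value (negParts N) := by
  rw [value_eq_iff] at h ⊢
  intro s
  rw [← negParts_add, wins_negParts]
  exact h _

noncomputable instance : AddCommGroup Value :=
  { (inferInstance : AddCommMonoid Value) with
    neg := fun x => value (negParts (exists_value x).choose)
    zsmul := @zsmulRec _ _ _ ⟨fun x => value (negParts (exists_value x).choose)⟩ nsmulRec
    neg_add_cancel := fun x => by
      change value (negParts (exists_value x).choose) + x = 0
      conv_lhs => rw [← (exists_value x).choose_spec]
      rw [value_negParts_congr (exists_value _).choose_spec, ← map_add, ← map_zero value,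
        value_eq_iff]
      intro s
      rw [negParts_zero, add_zero, add_comm]
      exact not_wins_add_neg s _ }

theorem value_add_negParts (M : Multiset Part) : value M + value (negParts M) = 0 := by
  rw [← map_add, ← map_zero value, value_eq_iff]
  intro s
  rw [negParts_zero, add_zero]
  exact not_wins_add_neg s M

theorem value_negParts (M : Multiset Part) : value (negParts M) = -value M :=
  eq_neg_of_add_eq_zero_right (value_add_negParts M)

/-- Left wins when moving second. -/
def NonNeg (x : Value) : Prop := ∃ M, value M = x ∧ ¬ Wins Right M

/-- Left wins when moving first. -/
def LeftFirst (x : Value) : Prop := ¬ NonNeg (-x)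

theorem nonNeg_value {M : Multiset Part} : NonNeg (value M) ↔ ¬ Wins Right M := by
  refine ⟨?_, fun h => ⟨M, rfl, h⟩⟩
  rintro ⟨N, hN, hw⟩
  rw [value_eq_iff] at hN
  refine not_wins_of_add (Z := N + negParts N) ?_ (not_wins_add_neg _ _)
  have := not_wins_add hw ((value_eq_iff.1 (value_eq_iff.2 hN).symm) Right)
  rwa [show N + (M + negParts N) = M + (N + negParts N) by abel] at this

theorem leftFirst_value {M : Multiset Part} : LeftFirst (value M) ↔ Wins Left M := by
  rw [LeftFirst, ← value_negParts, nonNeg_value, not_not, wins_negParts]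
  rfl

theorem nonNeg_zero : NonNeg 0 := by
  rw [← map_zero value, nonNeg_value, not_wins_iff]
  intro N h
  have := h.stones_lt
  simp [stones] at this

theorem eq_zero_of_nonNeg {x : Value} (h1 : NonNeg x) (h2 : NonNeg (-x)) : x = 0 := by
  obtain ⟨M, rfl⟩ := exists_value x
  rw [← value_negParts, nonNeg_value, wins_negParts] at h2
  rw [nonNeg_value] at h1
  rw [← map_zero value, value_eq_iff, negParts_zero, add_zero]
  exact opp_rec Right h1 h2

/-- The value of a part. -/
def val (p : Part) : Value := value {p}

theorem value_eq_sum (M : Multiset Part) : value M = (M.map val).sum := by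
  induction M using Multiset.induction_on with
  | empty => simp
  | cons p M ih => rw [← Multiset.singleton_add, map_add, ih]; simp [val]

@[simp] theorem value_cons (p : Part) (M : Multiset Part) :
    value (p ::ₘ M) = val p + value M := by simp [value_eq_sum]

theorem val_negPart (p : Part) : val (negPart p) = -val p := by
  rw [val, val, ← value_negParts]; simp [negParts]

/-- `x` is the value of what remains of the part `p` after a move by `s`. -/
def IsOption (s : Color) (p : Part) (x : Value) : Prop :=
  ∃ q r, PartMove s p q r ∧ x = val q + val r

theorem nonNeg_of_options {M : Multiset Part} {x : Value} (hx : x = value M)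
    (h : ∀ p ∈ M, ∀ y, IsOption Right p y → LeftFirst (x - val p + y)) : NonNeg x := by
  rw [hx, nonNeg_value, not_wins_iff]
  intro N hN
  cases hN with
  | intro p q r C hp =>
    have := h p (Multiset.mem_cons_self _ _) _ ⟨q, r, hp, rfl⟩
    have e : x - val p + (val q + val r) = value (q ::ₘ r ::ₘ C) := by
      rw [hx]; simp only [value_cons]; abel
    rwa [e, leftFirst_value] at this

theorem leftFirst_of_option {M : Multiset Part} {x y : Value} {p : Part} (hx : x = value M)
    (hp : p ∈ M) (hy : IsOption Left p y) (h : NonNeg (x - val p + y)) : LeftFirst x := by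
  rw [hx, leftFirst_value, wins_iff]
  obtain ⟨C, rfl⟩ := Multiset.exists_cons_of_mem hp
  obtain ⟨q, r, hpq, rfl⟩ := hy
  refine ⟨_, .intro _ _ _ C hpq, ?_⟩
  have e : x - val p + (val q + val r) = value (q ::ₘ r ::ₘ C) := by
    rw [hx]; simp only [value_cons]; abel
  rwa [e, nonNeg_value] at h

theorem val_eq_zero_of_no_move {p : Part} (h : ∀ s q r, ¬ PartMove s p q r) : val p = 0 := by
  rw [val, ← map_zero value, value_eq_iff]
  intro s
  rw [negParts_zero, add_zero, not_wins_iff]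
  intro N hN
  generalize hM : ({p} : Multiset Part) = M at hN
  cases hN with
  | intro p' q r C hp =>
    obtain ⟨rfl, -⟩ := (Multiset.singleton_eq_cons_iff _).1 hM
    exact absurd hp (h _ _ _)

theorem PartMove.mem {s : Color} {p q r : Part} (H : PartMove s p q r) (t : Color) : t ∈ p := by
  cases H <;> exact opp_rec s (by simp) (by simp) t

theorem val_eq_zero_of_notMem {p : Part} {t : Color} (h : t ∉ p) : val p = 0 :=
  val_eq_zero_of_no_move fun _ _ _ H => h (H.mem t)

@[simp] theorem val_nil : val [] = 0 := val_eq_zero_of_notMem (t := .x) (by simp)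

theorem SumMove.map_reverse {s : Color} {M N : Multiset Part} (H : SumMove s M N) :
    SumMove s (M.map List.reverse) (N.map List.reverse) := by
  cases H with
  | intro p q r C h =>
    rw [Multiset.map_cons, Multiset.map_cons, Multiset.map_cons, Multiset.cons_swap]
    exact .intro _ _ _ _ h.reverse

theorem Wins.map_reverse {s : Color} {M : Multiset Part} (H : Wins s M) :
    Wins s (M.map List.reverse) := by
  induction H with
  | intro M N hmove _ ih =>
    refine .intro _ _ hmove.map_reverse fun K hK => ?_
    simpa using ih (K.map List.reverse)
      (by simpa [Function.comp_def] using hK.map_reverse)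

theorem val_reverse (p : Part) : val p.reverse = val p := by
  rw [val, val, value_eq_iff]
  have key : ∀ s (N : Multiset Part), (∀ M, N = M.map List.reverse + negParts M → ¬ Wins s N) := by
    intro s N
    induction hn : stones N using Nat.strong_induction_on generalizing s N with
    | _ n ih =>
      rintro M rfl
      rw [not_wins_iff]
      intro K hK
      rcases sumMove_add.1 hK with ⟨M', h, rfl⟩ | ⟨N', h, rfl⟩
      · have h' := h.map_reverse
        simp only [Multiset.map_map, Function.comp_def, List.reverse_reverse,
          Multiset.map_id'] at h'
        have h1 := h.stones_lt
        have h2 := h'.neg.stones_lt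
        refine wins_iff.2 ⟨M' + negParts (M'.map List.reverse),
          sumMove_add.2 (.inr ⟨_, h'.neg, rfl⟩), ?_⟩
        simp only [stones_add] at hn
        exact ih _ (by rw [← hn, stones_add]; omega) _ _ rfl (M'.map List.reverse)
          (by simp)
      · obtain ⟨M', h', rfl⟩ := sumMove_negParts h
        have h1 := h.stones_lt
        have h2 := h'.map_reverse.stones_lt
        refine wins_iff.2 ⟨_, sumMove_add.2 (.inl ⟨_, h'.map_reverse, rfl⟩), ?_⟩
        simp only [stones_add] at hn
        exact ih _ (by rw [← hn, stones_add]; omega) _ _ rfl M' rfl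
  intro s
  exact key s _ {p} (by simp)

theorem SamePart.val_eq {p q : Part} (h : SamePart p q) : val p = val q := by
  rcases h with rfl | rfl
  · rfl
  · exact val_reverse q

/-! ### Evaluation of small positions -/

/-- Decides whether two parts are the same string. -/
def Part.beq : Part → Part → Bool
  | [], [] => true
  | .x :: p, .x :: q => Part.beq p q
  | .o :: p, .o :: q => Part.beq p q
  | _, _ => false

theorem Part.eq_of_beq : ∀ {p q : Part}, Part.beq p q = true → p = q
  | [], [], _ => rfl
  | .x :: p, .x :: q, h => by rw [Part.eq_of_beq (p := p) (q := q) h]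
  | .o :: p, .o :: q, h => by rw [Part.eq_of_beq (p := p) (q := q) h]
  | .x :: p, .o :: q, h => by simp [Part.beq] at h
  | .o :: p, .x :: q, h => by simp [Part.beq] at h
  | [], _ :: _, h => by simp [Part.beq] at h
  | _ :: _, [], h => by simp [Part.beq] at h

/-- Decides whether two parts are the same up to reversal. -/
def Part.same (p q : Part) : Bool := Part.beq p q || Part.beq p q.reverse

theorem Part.val_eq_of_same {p q : Part} (h : Part.same p q = true) : val p = val q := by
  rw [Part.same, Bool.or_eq_true] at h
  exact SamePart.val_eq (h.imp Part.eq_of_beq Part.eq_of_beq)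

/-- The moves of `s` in the part `l.reverse ++ p` that take place in `p`. Of the two remaining
parts the first one is reversed. -/
def partMovesAux (s : Color) : Part → Part → List (Part × Part)
  | l, .x :: .o :: r =>
    (match s with
      | .x => (l, .x :: r)
      | .o => (.o :: l, r)) :: partMovesAux s (.x :: l) (.o :: r)
  | l, .o :: .x :: r =>
    (match s with
      | .x => (.x :: l, r)
      | .o => (l, .o :: r)) :: partMovesAux s (.o :: l) (.x :: r)
  | l, a :: b :: r => partMovesAux s (a :: l) (b :: r)
  | _, _ => []

theorem isOption_of_mem_partMovesAux {s : Color} (p l : Part) :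
    ∀ m ∈ partMovesAux s l p, IsOption s (l.reverse ++ p) (val m.1 + val m.2) := by
  have tail : ∀ (a b : Color) (r : Part), (∀ m ∈ partMovesAux s (a :: l) (b :: r),
      IsOption s ((a :: l).reverse ++ b :: r) (val m.1 + val m.2)) →
      ∀ m ∈ partMovesAux s (a :: l) (b :: r),
      IsOption s (l.reverse ++ a :: b :: r) (val m.1 + val m.2) := by
    intro a b r h m hm
    simpa using h m hm
  match p with
  | .x :: .o :: r =>
    intro m hm
    rcases List.mem_cons.1 hm with rfl | hm
    · cases s
      · exact ⟨_, _, .clobberRight _ _, by rw [val_reverse]⟩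
      · exact ⟨_, _, .clobberLeft _ _, by rw [← val_reverse (.o :: l)]; simp⟩
    · exact tail _ _ _ (isOption_of_mem_partMovesAux _ _) m hm
  | .o :: .x :: r =>
    intro m hm
    rcases List.mem_cons.1 hm with rfl | hm
    · cases s
      · exact ⟨_, _, .clobberLeft _ _, by rw [← val_reverse (.x :: l)]; simp⟩
      · exact ⟨_, _, .clobberRight _ _, by rw [val_reverse]⟩
    · exact tail _ _ _ (isOption_of_mem_partMovesAux _ _) m hm
  | .x :: .x :: r =>
    intro m hm
    rw [partMovesAux] at hm
    · exact tail _ _ _ (isOption_of_mem_partMovesAux _ _) m hm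
    all_goals simp
  | .o :: .o :: r =>
    intro m hm
    rw [partMovesAux] at hm
    · exact tail _ _ _ (isOption_of_mem_partMovesAux _ _) m hm
    all_goals simp
  | [] => simp [partMovesAux]
  | [a] => simp [partMovesAux]

theorem partMovesAux_subset {s a b : Color} {l r : Part} :
    partMovesAux s (a :: l) (b :: r) ⊆ partMovesAux s l (a :: b :: r) := by
  cases a <;> cases b <;> simp [partMovesAux]

theorem mem_partMovesAux_right (s : Color) (k r : Part) (l : Part) :
    (k.reverse ++ l, s :: r) ∈ partMovesAux s l (k ++ s :: s.opp :: r) := by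
  induction k generalizing l with
  | nil => cases s <;> simp [partMovesAux]
  | cons a k ih =>
    have := ih (a :: l)
    cases k with
    | nil => exact partMovesAux_subset (by simpa using this)
    | cons b k => exact partMovesAux_subset (by simpa using this)

theorem mem_partMovesAux_left (s : Color) (k r : Part) (l : Part) :
    (s :: (k.reverse ++ l), r) ∈ partMovesAux s l (k ++ s.opp :: s :: r) := by
  induction k generalizing l with
  | nil => cases s <;> simp [partMovesAux]
  | cons a k ih =>
    have := ih (a :: l)
    cases k with
    | nil => exact partMovesAux_subset (by simpa using this)
    | cons b k => exact partMovesAux_subset (by simpa using this)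

theorem exists_mem_partMovesAux {s : Color} {p : Part} {y : Value} (h : IsOption s p y) :
    ∃ m ∈ partMovesAux s [] p, y = val m.1 + val m.2 := by
  obtain ⟨q, r, H, rfl⟩ := h
  cases H with
  | clobberRight _ t =>
    exact ⟨_, mem_partMovesAux_right s q t [], by simp [val_reverse]⟩
  | clobberLeft l _ =>
    refine ⟨_, mem_partMovesAux_left s l r [], ?_⟩
    rw [← val_reverse (l ++ [s])]
    simp

/-- The positions that `s` can reach by one move. -/
def sumMoves (s : Color) : List Part → List (List Part)
  | [] => []
  | p :: M => (partMovesAux s [] p).map (fun m => m.1 :: m.2 :: M) ++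
      (sumMoves s M).map (fun N => p :: N)

/-- The value of a list of parts. -/
def listValue (M : List Part) : Value := value (M : Multiset Part)

@[simp] theorem listValue_nil : listValue [] = 0 := map_zero value

@[simp] theorem listValue_cons (p : Part) (M : List Part) :
    listValue (p :: M) = val p + listValue M := by
  rw [listValue, ← Multiset.cons_coe, value_cons]; rfl

theorem listValue_map_negPart (M : List Part) : listValue (M.map negPart) = -listValue M := by
  induction M with
  | nil => simp
  | cons p M ih => simp [ih, val_negPart, add_comm]

theorem exists_mem_sumMoves {s : Color} {M : List Part} {p : Part} {y : Value} (hp : p ∈ M)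
    (hy : IsOption s p y) : ∃ N ∈ sumMoves s M, listValue N = listValue M - val p + y := by
  induction M with
  | nil => simp at hp
  | cons q M ih =>
    rcases List.mem_cons.1 hp with rfl | hp
    · obtain ⟨m, hm, rfl⟩ := exists_mem_partMovesAux hy
      refine ⟨m.1 :: m.2 :: M, ?_, ?_⟩
      · exact List.mem_append_left _ (List.mem_map.2 ⟨m, hm, rfl⟩)
      · simp only [listValue_cons]; abel
    · obtain ⟨N, hN, h⟩ := ih hp
      refine ⟨q :: N, List.mem_append_right _ (List.mem_map.2 ⟨N, hN, rfl⟩), ?_⟩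
      rw [listValue_cons, h, listValue_cons]; abel

theorem isOption_of_mem_sumMoves {s : Color} {M N : List Part} (hN : N ∈ sumMoves s M) :
    ∃ p ∈ M, ∃ y, IsOption s p y ∧ listValue N = listValue M - val p + y := by
  induction M generalizing N with
  | nil => simp [sumMoves] at hN
  | cons q M ih =>
    rw [sumMoves, List.mem_append, List.mem_map, List.mem_map] at hN
    rcases hN with ⟨m, hm, rfl⟩ | ⟨N, hN, rfl⟩
    · refine ⟨q, by simp, _, isOption_of_mem_partMovesAux q [] m hm, ?_⟩
      simp only [listValue_cons]; abel
    · obtain ⟨p, hp, y, hy, h⟩ := ih hN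
      refine ⟨p, by simp [hp], y, hy, ?_⟩
      rw [listValue_cons, h, listValue_cons]; abel

/-- Looks a part or its negative up in a table. -/
def lookupPart : List (Part × List Part) → Part → List Part
  | [], p => [p]
  | (q, N) :: T, p =>
    bif Part.same p q then N
    else bif Part.same (negPart p) q then N.map negPart
    else lookupPart T p

/-- A table of parts with collections of parts of the same value. -/
def TableSound (T : List (Part × List Part)) : Prop := ∀ e ∈ T, val e.1 = listValue e.2

theorem listValue_lookupPart {T : List (Part × List Part)} (hT : TableSound T) (p : Part) :
    listValue (lookupPart T p) = val p := by
  induction T with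
  | nil => simp [lookupPart]
  | cons e T ih =>
    obtain ⟨q, N⟩ := e
    have h1 : val q = listValue N := hT (q, N) (by simp)
    have h2 := ih fun e he => hT e (by simp [he])
    rw [lookupPart]
    cases hpq : Part.same p q with
    | true => rw [cond_true, ← h1, Part.val_eq_of_same hpq]
    | false =>
      cases hnpq : Part.same (negPart p) q with
      | true =>
        rw [cond_false, cond_true, listValue_map_negPart, ← h1, ← Part.val_eq_of_same hnpq,
          val_negPart, neg_neg]
      | false => rwa [cond_false, cond_false]

/-- Adds a part to a list of parts: drops it if it has stones of one colour only, and cancels it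
against its negative. -/
def insertPart (p : Part) : List Part → List Part
  | [] => bif p.all (· matches .x) || p.all (· matches .o) then [] else [p]
  | q :: M => bif Part.same (negPart p) q then M else q :: insertPart p M

theorem listValue_insertPart (p : Part) (M : List Part) :
    listValue (insertPart p M) = val p + listValue M := by
  induction M with
  | nil =>
    rw [insertPart]
    cases h : p.all (· matches .x) || p.all (· matches .o) with
    | false => simp
    | true =>
      rw [Bool.or_eq_true, List.all_eq_true, List.all_eq_true] at h
      rcases h with h | h
      · rw [val_eq_zero_of_notMem (t := .o) fun hm => by simpa using h _ hm]; simp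
      · rw [val_eq_zero_of_notMem (t := .x) fun hm => by simpa using h _ hm]; simp
  | cons q M ih =>
    rw [insertPart]
    cases h : Part.same (negPart p) q with
    | true => rw [listValue_cons, ← Part.val_eq_of_same h, val_negPart]; simp
    | false => rw [cond_false, listValue_cons, ih, listValue_cons]; abel

/-- Simplifies a list of parts by means of a table. -/
def simplify (T : List (Part × List Part)) : List Part → List Part
  | [] => []
  | p :: M => (lookupPart T p).foldr insertPart (simplify T M)

theorem listValue_simplify {T : List (Part × List Part)} (hT : TableSound T) (M : List Part) :
    listValue (simplify T M) = listValue M := by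
  induction M with
  | nil => rfl
  | cons p M ih =>
    have : ∀ L : List Part, listValue (L.foldr insertPart (simplify T M)) =
        listValue L + listValue M := by
      intro L
      induction L with
      | nil => simpa using ih
      | cons q L ih' => rw [List.foldr_cons, listValue_insertPart, ih', listValue_cons]; abel
    rw [simplify, this, listValue_lookupPart hT, listValue_cons]

/-- Inserts a position into a list of positions sorted by their weights. -/
def insertByWeight (e : ℕ × List Part) : List (ℕ × List Part) → List (ℕ × List Part)
  | [] => [e]
  | f :: L => bif Nat.ble e.1 f.1 then e :: f :: L else f :: insertByWeight e L

theorem mem_of_mem_insertByWeight {e f : ℕ × List Part} {L : List (ℕ × List Part)}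
    (h : f ∈ insertByWeight e L) : f = e ∨ f ∈ L := by
  induction L with
  | nil => simpa [insertByWeight] using h
  | cons g L ih =>
    rw [insertByWeight] at h
    cases hb : Nat.ble e.1 g.1 with
    | true => rw [hb, cond_true, List.mem_cons] at h; exact h
    | false =>
      rw [hb, cond_false, List.mem_cons] at h
      rcases h with rfl | h
      · simp
      · exact (ih h).imp_right (by simp +contextual)

/-- The simplified positions that Left can reach by one move, the smallest ones first. -/
def leftReplies (T : List (Part × List Part)) (M : List Part) : List (ℕ × List Part) :=
  (sumMoves .x M).foldr
    (fun N L => insertByWeight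
      ((simplify T N).foldr (fun p n => p.length + n) 0, simplify T N) L) []

theorem exists_of_mem_leftReplies {T : List (Part × List Part)} {M : List Part}
    {e : ℕ × List Part} (h : e ∈ leftReplies T M) :
    ∃ N ∈ sumMoves .x M, e.2 = simplify T N := by
  rw [leftReplies] at h
  generalize sumMoves .x M = S at h ⊢
  induction S with
  | nil => simp at h
  | cons N L ih =>
    rw [List.foldr_cons] at h
    rcases mem_of_mem_insertByWeight h with rfl | h
    · exact ⟨N, by simp, rfl⟩
    · obtain ⟨N', h', he⟩ := ih h
      exact ⟨N', by simp [h'], he⟩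

/-- Searches for a proof that Left, moving second, wins in at most `n` moves. -/
def leftWinsSecond (T : List (Part × List Part)) : ℕ → List Part → Bool
  | 0, _ => false
  | n + 1, M => (sumMoves .o M).all fun N =>
      (leftReplies T (simplify T N)).any fun e => leftWinsSecond T n e.2

theorem nonNeg_of_leftWinsSecond {T : List (Part × List Part)} (hT : TableSound T) {n : ℕ}
    {M : List Part} (h : leftWinsSecond T n M = true) : NonNeg (listValue M) := by
  induction n generalizing M with
  | zero => simp [leftWinsSecond] at h
  | succ n ih =>
    rw [leftWinsSecond, List.all_eq_true] at h
    refine nonNeg_of_options (M := (M : Multiset Part)) rfl fun p hp y hy => ?_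
    obtain ⟨N, hN, hv⟩ := exists_mem_sumMoves (Multiset.mem_coe.1 hp) hy
    obtain ⟨e, he, hw⟩ := List.any_eq_true.1 (h N hN)
    obtain ⟨K, hK, hs⟩ := exists_of_mem_leftReplies he
    obtain ⟨q, hq, z, hz, hv'⟩ := isOption_of_mem_sumMoves hK
    rw [← hv, ← listValue_simplify hT]
    refine leftFirst_of_option (M := (simplify T N : Multiset Part)) rfl
      (Multiset.mem_coe.2 hq) hz ?_
    rw [← hv', ← listValue_simplify hT, ← hs]
    exact ih hw

theorem val_eq_of_leftWinsSecond {T : List (Part × List Part)} (hT : TableSound T) (n : ℕ)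
    {p : Part} {M : List Part}
    (h : (leftWinsSecond T n (p :: M.map negPart) && leftWinsSecond T n (negPart p :: M)) = true) :
    val p = listValue M := by
  rw [Bool.and_eq_true] at h
  refine sub_eq_zero.1 (eq_zero_of_nonNeg ?_ ?_)
  · have := nonNeg_of_leftWinsSecond hT h.1
    rwa [listValue_cons, listValue_map_negPart, ← sub_eq_add_neg] at this
  · have := nonNeg_of_leftWinsSecond hT h.2
    rwa [listValue_cons, val_negPart, ← sub_eq_neg_add, ← neg_sub] at this

/-- Values of small parts. -/
def smallTable : List (Part × List Part) :=
  [(ooEndxx 4, []), (o 3, [a 2]), (oo 4, [xxo, a 2]), (oo 5, [a 2]), (ooEndoo 5, [oo 3]),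
    (a 6, []), (ooEndxx 6, [a 4, a 2]), (ooEndoo 7, [a 2]), (o 9, [xxo, a 2]),
    (a 12, [a 4, a 2])]

theorem tableSound_smallTable : TableSound smallTable := by
  have h0 : TableSound [] := fun e he => absurd he (by simp)
  have step : ∀ {T : List (Part × List Part)} {e : Part × List Part}, TableSound T →
      val e.1 = listValue e.2 → TableSound (e :: T) := fun hT he f hf => by
    rcases List.mem_cons.1 hf with rfl | hf
    exacts [he, hT f hf]
  have h1 := step (e := (ooEndxx 4, [])) h0 (val_eq_of_leftWinsSecond h0 20 (by decide +kernel))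
  have h2 := step (e := (o 3, [a 2])) h1 (val_eq_of_leftWinsSecond h1 20 (by decide +kernel))
  have h3 := step (e := (oo 4, [xxo, a 2])) h2
    (val_eq_of_leftWinsSecond h2 20 (by decide +kernel))
  have h4 := step (e := (oo 5, [a 2])) h3 (val_eq_of_leftWinsSecond h3 20 (by decide +kernel))
  have h5 := step (e := (ooEndoo 5, [oo 3])) h4
    (val_eq_of_leftWinsSecond h4 20 (by decide +kernel))
  have h6 := step (e := (a 6, [])) h5 (val_eq_of_leftWinsSecond h5 20 (by decide +kernel))
  have h7 := step (e := (ooEndxx 6, [a 4, a 2])) h6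
    (val_eq_of_leftWinsSecond h6 20 (by decide +kernel))
  have h8 := step (e := (ooEndoo 7, [a 2])) h7
    (val_eq_of_leftWinsSecond h7 20 (by decide +kernel))
  have h9 := step (e := (o 9, [xxo, a 2])) h8
    (val_eq_of_leftWinsSecond h8 20 (by decide +kernel))
  have h10 := step (e := (a 12, [a 4, a 2])) h9
    (val_eq_of_leftWinsSecond h9 20 (by decide +kernel))
  intro e he
  refine h10 e ?_
  simp only [smallTable, List.mem_cons, List.not_mem_nil, or_false] at he ⊢
  tauto

theorem nonNeg_o5_oo3_a2_a4 : NonNeg (val (o 5) + (val (oo 3) + (val (a 2) + val (a 4)))) := by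
  simpa using nonNeg_of_leftWinsSecond tableSound_smallTable (n := 20)
    (M := [o 5, oo 3, a 2, a 4]) (by decide +kernel)

theorem nonNeg_a14_xxo_a2_a4 : NonNeg (val (a 14) + (val xxo + (val (a 2) + val (a 4)))) := by
  simpa using nonNeg_of_leftWinsSecond tableSound_smallTable (n := 20)
    (M := [a 14, xxo, a 2, a 4]) (by decide +kernel)

/-! ### Alternating strings -/

theorem alt_two_mul_add (c : Color) (i j : ℕ) :
    alt c (2 * i + j) = alt c (2 * i) ++ alt c j := by
  induction i with
  | zero => simp [alt]
  | succ i ih =>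
    rw [show 2 * (i + 1) + j = 2 * i + j + 1 + 1 by ring, show 2 * (i + 1) = 2 * i + 1 + 1 by ring]
    simp [alt, ih]

theorem alt_two_mul_add_one_add (c : Color) (i j : ℕ) :
    alt c (2 * i + 1 + j) = alt c (2 * i + 1) ++ alt c.opp j := by
  rw [add_assoc, alt_two_mul_add, alt_two_mul_add c i 1, add_comm 1 j]
  simp [alt]

theorem reverse_alt_even (c : Color) (i : ℕ) : (alt c (2 * i)).reverse = alt c.opp (2 * i) := by
  induction i with
  | zero => rfl
  | succ i ih =>
    rw [mul_add, alt_two_mul_add, List.reverse_append, ih, add_comm, mul_one, add_comm 2]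
    simp [alt]

theorem reverse_alt_odd (c : Color) (i : ℕ) :
    (alt c (2 * i + 1)).reverse = alt c (2 * i + 1) := by
  conv_rhs => rw [alt_two_mul_add]
  rw [alt, List.reverse_cons, reverse_alt_even, Color.opp_opp]
  rfl

theorem alt_eq_append {c s : Color} {m : ℕ} {l r : Part}
    (h : alt c m = l ++ s :: s.opp :: r) :
    ∃ i j, m = i + 2 + j ∧ l = alt c i ∧ r = alt s j ∧ (c = s ↔ i % 2 = 0) := by
  induction l generalizing c m with
  | nil =>
    match m with
    | 0 => simp [alt] at h
    | 1 => simp [alt] at h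
    | j + 2 =>
      simp only [alt, List.nil_append, List.cons.injEq, Color.opp_opp] at h
      obtain ⟨rfl, -, rfl⟩ := h
      exact ⟨0, j, by omega, rfl, rfl, by simp⟩
  | cons d l ih =>
    match m with
    | 0 => simp [alt] at h
    | m + 1 =>
      simp only [alt, List.cons_append, List.cons.injEq] at h
      obtain ⟨rfl, h⟩ := h
      obtain ⟨i, j, rfl, rfl, rfl, hc⟩ := ih h
      refine ⟨i + 1, j, by omega, rfl, rfl, ?_⟩
      have : c = s ↔ ¬ c.opp = s := by cases c <;> cases s <;> simp
      rw [this, hc]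
      omega

theorem alt_o_eq_append_o {m : ℕ} {l r : Part} (h : alt .o m = l ++ .o :: .x :: r) :
    ∃ i j, m = 2 * i + 2 + j ∧ l = alt .o (2 * i) ∧ r = alt .o j := by
  obtain ⟨i, j, hm, hl, hr, hc⟩ := alt_eq_append (s := .o) h
  have : i = 2 * (i / 2) := by have := hc.1 rfl; omega
  exact ⟨i / 2, j, by omega, by rw [hl, ← this], hr⟩

theorem IsOption.forward {s : Color} {p : Part} {y : Value} (h : IsOption s p y) :
    ∃ l r, (p = l ++ s :: s.opp :: r ∨ p.reverse = l ++ s :: s.opp :: r) ∧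
      y = val l + val (s :: r) := by
  obtain ⟨q, r, H, rfl⟩ := h
  cases H with
  | clobberRight _ t => exact ⟨q, t, .inl rfl, rfl⟩
  | clobberLeft l _ =>
    refine ⟨r.reverse, l.reverse, .inr (by simp), ?_⟩
    rw [← val_reverse (l ++ [s]), val_reverse r, add_comm]
    simp

theorem isOption_right {s : Color} {p : Part} (l r : Part) (h : p = l ++ s :: s.opp :: r) :
    IsOption s p (val l + val (s :: r)) := by
  subst h; exact ⟨_, _, .clobberRight _ _, rfl⟩

theorem isOption_left {s : Color} {p : Part} (l r : Part) (h : p = l ++ s.opp :: s :: r) :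
    IsOption s p (val (l ++ [s]) + val r) := by
  subst h; exact ⟨_, _, .clobberLeft _ _, rfl⟩

/-- The value of `o (2 * n + 1)`. -/
def valO (n : ℕ) : Value := val (o (2 * n + 1))

/-- The value of `oo (2 * n)`. -/
def valoO (n : ℕ) : Value := val (oo (2 * n))

/-- The value of `ooEndoo (2 * n + 1)`. -/
def valoOo (n : ℕ) : Value := val (ooEndoo (2 * n + 1))

/-- The value of `a (2 * n)`. -/
def valA (n : ℕ) : Value := val (a (2 * n))

/-- The value of `oo (2 * n + 1)`. -/
def valoA (n : ℕ) : Value := val (oo (2 * n + 1))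

/-! ### The moves of Right -/

theorem isOption_right_o {n : ℕ} {y : Value} (hy : IsOption .o (o (2 * n + 1)) y) :
    ∃ i j, 1 ≤ i ∧ i + j = n ∧ y = valoO i + valA j := by
  obtain ⟨l, r, h, rfl⟩ := hy.forward
  rw [o, reverse_alt_odd, or_self] at h
  obtain ⟨i, j, hm, rfl, rfl⟩ := alt_o_eq_append_o h
  refine ⟨n - i, i, by omega, by omega, ?_⟩
  rw [add_comm, valoO, valA, oo, a, show 2 * (n - i) - 1 = j by omega]

theorem eq_cons_of_double {m : ℕ} {l r q : Part} (h : .o :: (alt .o m ++ q) = l ++ .o :: .x :: r)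
    (hm : 1 ≤ m) : ∃ l', l = .o :: l' ∧ alt .o m ++ q = l' ++ .o :: .x :: r := by
  cases l with
  | nil =>
    obtain ⟨k, rfl⟩ := Nat.exists_eq_add_of_le' hm
    simp [alt] at h
  | cons b l =>
    simp only [List.cons_append, List.cons.injEq] at h
    exact ⟨l, by rw [← h.1], h.2⟩

theorem exists_append_singleton {m : ℕ} {l r : Part}
    (h : alt .o (2 * m + 1) ++ [.o] = l ++ .o :: .x :: r) :
    ∃ r', r = r' ++ [.o] ∧ alt .o (2 * m + 1) = l ++ .o :: .x :: r' := by
  rcases List.eq_nil_or_concat r with rfl | ⟨r', b, rfl⟩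
  · have := congrArg List.reverse h
    simp at this
  · rw [List.concat_eq_append] at *
    have h' : alt .o (2 * m + 1) ++ [.o] = (l ++ .o :: .x :: r') ++ [b] := by simpa using h
    obtain ⟨h1, h2⟩ := List.append_inj' h' rfl
    simp only [List.cons.injEq, and_true] at h2
    exact ⟨r', by rw [h2], h1⟩

theorem isOption_right_oo {n : ℕ} (hn : 1 ≤ n) {y : Value} (hy : IsOption .o (oo (2 * n)) y) :
    ∃ i j, 1 ≤ j ∧ i + j + 1 = n ∧ (y = valoA i + valoO j ∨ y = valA i + valoOo j) := by
  obtain ⟨m, rfl⟩ := Nat.exists_eq_add_of_le' hn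
  have e : oo (2 * (m + 1)) = .o :: alt .o (2 * m + 1) := rfl
  obtain ⟨l, r, h | h, rfl⟩ := hy.forward
  · rw [e, ← List.append_nil (alt _ _)] at h
    obtain ⟨l', rfl, h'⟩ := eq_cons_of_double h (by omega)
    rw [List.append_nil] at h'
    obtain ⟨i, j, hm, rfl, rfl⟩ := alt_o_eq_append_o h'
    refine ⟨i, m - i, by omega, by omega, .inl ?_⟩
    rw [valoA, valoO, oo, oo, show 2 * (m - i) - 1 = j by omega, Nat.add_sub_cancel]
  · rw [e, List.reverse_cons, reverse_alt_odd] at h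
    obtain ⟨r', rfl, h'⟩ := exists_append_singleton h
    obtain ⟨i, j, hm, rfl, rfl⟩ := alt_o_eq_append_o h'
    refine ⟨i, m - i, by omega, by omega, .inr ?_⟩
    rw [valA, valoOo, a, ooEndoo, show 2 * (m - i) + 1 - 2 = j by omega]

theorem isOption_right_ooEndoo {n : ℕ} (hn : 1 ≤ n) {y : Value}
    (hy : IsOption .o (ooEndoo (2 * n + 1)) y) :
    ∃ i j, 1 ≤ j ∧ i + j + 1 = n ∧ y = valoA i + valoOo j := by
  obtain ⟨m, rfl⟩ := Nat.exists_eq_add_of_le' hn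
  have e : ooEndoo (2 * (m + 1) + 1) = .o :: (alt .o (2 * m + 1) ++ [.o]) := rfl
  obtain ⟨l, r, h, rfl⟩ := hy.forward
  rw [e, List.reverse_cons, List.reverse_append, reverse_alt_odd, List.reverse_singleton,
    List.singleton_append, List.cons_append, or_self] at h
  obtain ⟨l', rfl, h'⟩ := eq_cons_of_double h (by omega)
  obtain ⟨r', rfl, h''⟩ := exists_append_singleton h'
  obtain ⟨i, j, hm, rfl, rfl⟩ := alt_o_eq_append_o h''
  refine ⟨i, m - i, by omega, by omega, ?_⟩
  rw [valoA, valoOo, oo, ooEndoo, show 2 * (m - i) + 1 - 2 = j by omega, Nat.add_sub_cancel]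

theorem val_o_one : val [.o] = 0 := val_eq_zero_of_notMem (t := .x) (by simp)

theorem val_x_one : val [.x] = 0 := val_eq_zero_of_notMem (t := .o) (by simp)

theorem val_oo_two : val [.o, .o] = 0 := val_eq_zero_of_notMem (t := .x) (by simp)

theorem val_xx_two : val [.x, .x] = 0 := val_eq_zero_of_notMem (t := .o) (by simp)

theorem val_oxx : val ([.o, .x] ++ [.x]) = val xxo := val_reverse xxo

theorem val_oo_three : val (oo 3) = -val xxo := by rw [← val_negPart]; rfl

theorem isOption_right_a4 {y : Value} (h : IsOption .o (a 4) y) :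
    y = -val xxo ∨ y = val (a 2) ∨ y = 0 := by
  obtain ⟨m, hm, rfl⟩ := exists_mem_partMovesAux h
  simp only [a, alt, partMovesAux, Color.opp, List.mem_cons, List.not_mem_nil, or_false] at hm
  rcases hm with rfl | rfl | rfl
  · left; rw [val_nil, zero_add, ← val_oo_three]; rfl
  · right; right; rw [val_oo_two]; simp [val_eq_zero_of_notMem (t := .o)]
  · right; left; rw [val_o_one, add_zero, ← val_reverse]; rfl

theorem isOption_right_a2 {y : Value} (h : IsOption .o (a 2) y) : y = 0 := by
  obtain ⟨m, hm, rfl⟩ := exists_mem_partMovesAux h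
  simp only [a, alt, partMovesAux, Color.opp, List.mem_cons, List.not_mem_nil, or_false] at hm
  subst hm
  simp [val_o_one]

theorem isOption_right_xxo {y : Value} (h : IsOption .o xxo y) : y = val (a 2) := by
  obtain ⟨m, hm, rfl⟩ := exists_mem_partMovesAux h
  simp only [xxo, partMovesAux, List.mem_cons, List.not_mem_nil, or_false] at hm
  subst hm
  simp [a, alt]

theorem isOption_right_oo3 {y : Value} (h : IsOption .o (oo 3) y) : y = 0 := by
  obtain ⟨m, hm, rfl⟩ := exists_mem_partMovesAux h
  simp only [oo, alt, partMovesAux, List.mem_cons, Color.opp, List.not_mem_nil, or_false] at hm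
  subst hm
  simp [val_o_one]

/-! ### Some moves of Left -/

theorem isOption_o_sub_one (n : ℕ) : IsOption .x (o (2 * (n + 1) + 1)) (valO n) := by
  have := isOption_left (s := .x) (p := o (2 * (n + 1) + 1)) [] (o (2 * n + 1)) rfl
  rwa [List.nil_append, val_x_one, zero_add] at this

theorem isOption_o_xxo (n : ℕ) : IsOption .x (o (2 * (n + 2) + 1)) (val xxo + valO n) := by
  have := isOption_left (s := .x) (p := o (2 * (n + 2) + 1)) [.o, .x] (o (2 * n + 1)) rfl
  rwa [val_oxx] at this

theorem isOption_ooEndoo (n : ℕ) :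
    IsOption .x (ooEndoo (2 * (n + 2) + 1)) (val (a 2) + valoO (n + 1)) := by
  have := isOption_left (s := .x) (p := ooEndoo (2 * (n + 2) + 1)) [.o]
    (alt .o (2 * n + 1) ++ [.o]) rfl
  rwa [← val_reverse (alt .o _ ++ _), List.reverse_append, reverse_alt_odd] at this

theorem isOption_oo_a2_o (n : ℕ) : IsOption .x (oo (2 * (n + 2))) (val (a 2) + valO n) :=
  isOption_left (s := .x) (p := oo (2 * (n + 2))) [.o] (o (2 * n + 1)) rfl

theorem val_ooEndxx_four : val (ooEndxx 4) = 0 :=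
  tableSound_smallTable (ooEndxx 4, []) (by simp [smallTable])

theorem isOption_oo_o (n : ℕ) : IsOption .x (oo (2 * (n + 3))) (valO n) := by
  have := isOption_left (s := .x) (p := oo (2 * (n + 3))) [.o, .o, .x] (o (2 * n + 1)) rfl
  rwa [show val ([.o, .o, .x] ++ [.x]) = 0 from val_ooEndxx_four, zero_add] at this

theorem isOption_oo_sub_one (n : ℕ) : IsOption .x (oo (2 * (n + 2))) (valoO (n + 1)) := by
  have := isOption_right (s := .x) (p := oo (2 * (n + 2))) (oo (2 * (n + 1))) []
    (congrArg (Color.o :: ·) (alt_two_mul_add_one_add .o n 2))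
  rwa [val_x_one, add_zero] at this

theorem isOption_oo_xxo (n : ℕ) : IsOption .x (oo (2 * (n + 3))) (valoO (n + 1) + val xxo) :=
  isOption_right (s := .x) (p := oo (2 * (n + 3))) (oo (2 * (n + 1))) [.x, .o]
    (congrArg (Color.o :: ·) (alt_two_mul_add_one_add .o n 4))

theorem isOption_a_o (n : ℕ) : IsOption .x (a (2 * (n + 2))) (valO n) := by
  have := isOption_right (s := .x) (p := a (2 * (n + 2))) (o (2 * n + 1)) [.x]
    (alt_two_mul_add_one_add .o n 3)
  rwa [val_xx_two, add_zero] at this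

theorem isOption_a_xxo (n : ℕ) : IsOption .x (a (2 * (n + 2))) (val xxo + valA n) := by
  have := isOption_left (s := .x) (p := a (2 * (n + 2))) [.o, .x] (a (2 * n)) rfl
  rwa [val_oxx] at this

theorem isOption_a_sub_one (n : ℕ) : IsOption .x (a (2 * (n + 1))) (valA n) := by
  have := isOption_left (s := .x) (p := a (2 * (n + 1))) [] (a (2 * n)) rfl
  rwa [List.nil_append, val_x_one, zero_add] at this

theorem isOption_a10 : IsOption .x (a 10) (val (o 5) - val (oo 4)) := by
  have := isOption_right (s := .x) (p := a 10) (o 5) (alt .x 3) rfl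
  rwa [← val_negPart_oo_four] at this
where
  val_negPart_oo_four : -val (oo 4) = val (.x :: alt .x 3) := by rw [← val_negPart]; rfl

theorem isOption_oo_odd (n : ℕ) : IsOption .x (oo (2 * (n + 2) + 1)) (valoO (n + 1)) := by
  have := isOption_right (s := .x) (p := oo (2 * (n + 2) + 1)) (oo (2 * (n + 1))) [.x]
    (congrArg (Color.o :: ·) (alt_two_mul_add_one_add .o n 3))
  rwa [val_xx_two, add_zero] at this

theorem isOption_xxo : IsOption .x xxo 0 := by
  have := isOption_right (s := .x) (p := xxo) [.x] [] rfl
  rwa [val_x_one, add_zero] at this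

theorem isOption_oo3 : IsOption .x (oo 3) (val (a 2)) := by
  have := isOption_left (s := .x) (p := oo 3) [.o] [] rfl
  rwa [val_nil, add_zero] at this

/-! ### States -/

/-- A description of a position: the multisets of all `n` such that `o (2 * n + 1)`, `oo (2 * n)`,
`ooEndoo (2 * n + 1)` are parts, and the numbers of parts `xxo`, `oo 3`, `oo 6`, `oo 8`, `a 2`,
`a 4`. -/
structure State where
  A : Multiset ℕ
  B : Multiset ℕ
  C : Multiset ℕ
  e : ℕ
  w : ℕ
  k : ℕ
  f : ℕ
  d : ℕ
  h : ℕ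

namespace State

/-- The parts of the position that a state describes. -/
def parts (s : State) : Multiset Part :=
  s.A.map (fun n => o (2 * n + 1)) + s.B.map (fun n => oo (2 * n)) +
    s.C.map (fun n => ooEndoo (2 * n + 1)) + Multiset.replicate s.e xxo +
    Multiset.replicate s.w (oo 3) + Multiset.replicate s.k (oo 6) +
    Multiset.replicate s.f (oo 8) + Multiset.replicate s.d (a 2) + Multiset.replicate s.h (a 4)

/-- The value of the position that a state describes. -/
noncomputable def value (s : State) : Value :=
  (s.A.map valO).sum + (s.B.map valoO).sum + (s.C.map valoOo).sum + s.e • val xxo +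
    s.w • (-val xxo) + s.k • val (oo 6) + s.f • val (oo 8) + s.d • val (a 2) + s.h • val (a 4)

theorem value_eq (s : State) : s.value = Clobber.value s.parts := by
  rw [value_eq_sum, parts, value]
  simp only [Multiset.map_add, Multiset.sum_add, Multiset.map_map, Multiset.map_replicate,
    Multiset.sum_replicate, val_oo_three]
  rfl

/-- The parts occurring in a state lie in the sets `setO'`, `setoO'`, `setoOo'`. -/
structure Valid (s : State) : Prop where
  hA : ∀ n ∈ s.A, 2 ≤ n ∧ n ≠ 4
  hB : ∀ n ∈ s.B, 5 ≤ n
  hC : ∀ n ∈ s.C, 4 ≤ n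

/-- The measure for the induction. -/
def weight (s : State) : ℕ :=
  (s.A.map fun n => 2 * n + 1).sum + (s.B.map fun n => 2 * n).sum +
    (s.C.map fun n => 2 * n + 1).sum + 2 * s.e + 2 * s.w + 6 * s.k + 8 * s.f + s.d + 4 * s.h

/-- The number of parts in `setoOo'` that remain when `xxo` and `oo 3` cancel. -/
def numC (s : State) : ℕ := s.C.card + (s.w - s.e)

/-- The exceptional states. -/
def IsQ (s : State) : Prop :=
  s.B = 0 ∧ s.C = 0 ∧ s.e = s.w ∧ s.k = 0 ∧ s.f = 0 ∧
    ((s.A = {2} ∧ s.d % 2 = 1 ∧ s.h % 2 = 0) ∨ (s.A = {3} ∧ s.d % 2 = 0 ∧ s.h % 2 = 1) ∨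
      (s.A = {7} ∧ s.d % 2 = 1 ∧ s.h % 2 = 1))

theorem IsQ.facts {s : State} (h : s.IsQ) :
    s.A.card = 1 ∧ s.B.card = 0 ∧ s.C.card = 0 ∧ s.e = s.w ∧ s.k = 0 ∧ s.f = 0 ∧
      (s.d % 2 = 1 ∨ s.h % 2 = 1) := by
  obtain ⟨h1, h2, h3, h4, h5, h | h | h⟩ := h <;> simp [h1, h2, h3, h4, h5, h]

/-- Something remains after `x + x` is cancelled for `x` one of `a 2`, `a 4`, and also `xxo` is
cancelled against `oo 3`, whatever the numbers of parts `a 2`, `a 4` are. -/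
def Robust (s : State) : Prop :=
  s.A.card ≠ 0 ∨ s.B.card ≠ 0 ∨ s.C.card ≠ 0 ∨ s.e ≠ s.w ∨ s.k ≠ 0 ∨ s.f ≠ 0

/-- The condition under which Left wins moving first. -/
def Cond0 (s : State) : Prop :=
  s.numC ≤ s.A.card ∧ (s.Robust ∨ s.d % 2 = 1 ∨ s.h % 2 = 1)

/-- A condition under which Left wins moving second. -/
def Cond1 (s : State) : Prop := s.numC + 1 ≤ s.A.card ∧ ¬ s.IsQ

/-- Another condition under which Left wins moving second. -/
def Cond2 (s : State) : Prop :=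
  s.A.card = 0 ∧ s.B.card = 0 ∧ s.C.card = 0 ∧ s.w < s.e ∧
    (s.k + s.d % 2 + s.h % 2 = 0 ∨ 3 + s.w ≤ s.k + s.d % 2 + s.h % 2 + s.e ∨
      (s.f ≠ 0 ∧ s.h % 2 = 1))

/-! ### Moves in states -/

section

variable {A B C : Multiset ℕ} {e w k f d h : ℕ}

theorem value_A (n : ℕ) : value ⟨n ::ₘ A, B, C, e, w, k, f, d, h⟩ =
    value ⟨A, B, C, e, w, k, f, d, h⟩ + valO n := by simp [value]; abel

theorem value_B (n : ℕ) : value ⟨A, n ::ₘ B, C, e, w, k, f, d, h⟩ =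
    value ⟨A, B, C, e, w, k, f, d, h⟩ + valoO n := by simp [value]; abel

theorem value_C (n : ℕ) : value ⟨A, B, n ::ₘ C, e, w, k, f, d, h⟩ =
    value ⟨A, B, C, e, w, k, f, d, h⟩ + valoOo n := by simp [value]; abel

theorem value_e : value ⟨A, B, C, e + 1, w, k, f, d, h⟩ =
    value ⟨A, B, C, e, w, k, f, d, h⟩ + val xxo := by simp only [value, succ_nsmul]; abel

theorem value_w : value ⟨A, B, C, e, w + 1, k, f, d, h⟩ =
    value ⟨A, B, C, e, w, k, f, d, h⟩ - val xxo := by simp only [value, succ_nsmul]; abel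

theorem value_k : value ⟨A, B, C, e, w, k + 1, f, d, h⟩ =
    value ⟨A, B, C, e, w, k, f, d, h⟩ + val (oo 6) := by simp only [value, succ_nsmul]; abel

theorem value_f : value ⟨A, B, C, e, w, k, f + 1, d, h⟩ =
    value ⟨A, B, C, e, w, k, f, d, h⟩ + val (oo 8) := by simp only [value, succ_nsmul]; abel

theorem value_d : value ⟨A, B, C, e, w, k, f, d + 1, h⟩ =
    value ⟨A, B, C, e, w, k, f, d, h⟩ + val (a 2) := by simp only [value, succ_nsmul]; abel

theorem value_h : value ⟨A, B, C, e, w, k, f, d, h + 1⟩ =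
    value ⟨A, B, C, e, w, k, f, d, h⟩ + val (a 4) := by simp only [value, succ_nsmul]; abel

theorem mem_parts {s : State} {p : Part} : p ∈ s.parts ↔
    (∃ n ∈ s.A, o (2 * n + 1) = p) ∨ (∃ n ∈ s.B, oo (2 * n) = p) ∨
    (∃ n ∈ s.C, ooEndoo (2 * n + 1) = p) ∨ (s.e ≠ 0 ∧ p = xxo) ∨ (s.w ≠ 0 ∧ p = oo 3) ∨
    (s.k ≠ 0 ∧ p = oo 6) ∨ (s.f ≠ 0 ∧ p = oo 8) ∨ (s.d ≠ 0 ∧ p = a 2) ∨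
    (s.h ≠ 0 ∧ p = a 4) := by
  simp only [parts, Multiset.mem_add, Multiset.mem_map, Multiset.mem_replicate, or_assoc]

/-- Left wins moving first if a move leads to a position in which Left wins moving second. -/
theorem leftFirst {s : State} {p : Part} {y z : Value} (hp : p ∈ s.parts)
    (hy : IsOption Left p y) (hz : NonNeg z) (hv : s.value + y = z + val p) :
    LeftFirst s.value := by
  refine leftFirst_of_option s.value_eq hp hy ?_
  rwa [sub_add_eq_add_sub, hv, add_sub_cancel_right]

theorem leftFirst_A {n : ℕ} {y z : Value} (hy : IsOption Left (o (2 * n + 1)) y)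
    (hz : NonNeg z) (hv : value ⟨A, B, C, e, w, k, f, d, h⟩ + y = z) :
    LeftFirst (value ⟨n ::ₘ A, B, C, e, w, k, f, d, h⟩) :=
  leftFirst (mem_parts.2 (by simp)) hy hz (by rw [← hv, value_A, valO]; abel)

theorem leftFirst_B {n : ℕ} {y z : Value} (hy : IsOption Left (oo (2 * n)) y)
    (hz : NonNeg z) (hv : value ⟨A, B, C, e, w, k, f, d, h⟩ + y = z) :
    LeftFirst (value ⟨A, n ::ₘ B, C, e, w, k, f, d, h⟩) :=
  leftFirst (mem_parts.2 (by simp)) hy hz (by rw [← hv, value_B, valoO]; abel)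

theorem leftFirst_C {n : ℕ} {y z : Value} (hy : IsOption Left (ooEndoo (2 * n + 1)) y)
    (hz : NonNeg z) (hv : value ⟨A, B, C, e, w, k, f, d, h⟩ + y = z) :
    LeftFirst (value ⟨A, B, n ::ₘ C, e, w, k, f, d, h⟩) :=
  leftFirst (mem_parts.2 (by simp)) hy hz (by rw [← hv, value_C, valoOo]; abel)

theorem leftFirst_e {y z : Value} (hy : IsOption Left xxo y)
    (hz : NonNeg z) (hv : value ⟨A, B, C, e, w, k, f, d, h⟩ + y = z) :
    LeftFirst (value ⟨A, B, C, e + 1, w, k, f, d, h⟩) :=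
  leftFirst (mem_parts.2 (by simp)) hy hz (by rw [← hv, value_e]; abel)

theorem leftFirst_w {y z : Value} (hy : IsOption Left (oo 3) y)
    (hz : NonNeg z) (hv : value ⟨A, B, C, e, w, k, f, d, h⟩ + y = z) :
    LeftFirst (value ⟨A, B, C, e, w + 1, k, f, d, h⟩) :=
  leftFirst (mem_parts.2 (by simp)) hy hz (by rw [← hv, value_w, val_oo_three]; abel)

theorem leftFirst_k {y z : Value} (hy : IsOption Left (oo 6) y)
    (hz : NonNeg z) (hv : value ⟨A, B, C, e, w, k, f, d, h⟩ + y = z) :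
    LeftFirst (value ⟨A, B, C, e, w, k + 1, f, d, h⟩) :=
  leftFirst (mem_parts.2 (by simp)) hy hz (by rw [← hv, value_k]; abel)

theorem leftFirst_f {y z : Value} (hy : IsOption Left (oo 8) y)
    (hz : NonNeg z) (hv : value ⟨A, B, C, e, w, k, f, d, h⟩ + y = z) :
    LeftFirst (value ⟨A, B, C, e, w, k, f + 1, d, h⟩) :=
  leftFirst (mem_parts.2 (by simp)) hy hz (by rw [← hv, value_f]; abel)

theorem leftFirst_d {y z : Value} (hy : IsOption Left (a 2) y)
    (hz : NonNeg z) (hv : value ⟨A, B, C, e, w, k, f, d, h⟩ + y = z) :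
    LeftFirst (value ⟨A, B, C, e, w, k, f, d + 1, h⟩) :=
  leftFirst (mem_parts.2 (by simp)) hy hz (by rw [← hv, value_d]; abel)

theorem leftFirst_h {y z : Value} (hy : IsOption Left (a 4) y)
    (hz : NonNeg z) (hv : value ⟨A, B, C, e, w, k, f, d, h⟩ + y = z) :
    LeftFirst (value ⟨A, B, C, e, w, k, f, d, h + 1⟩) :=
  leftFirst (mem_parts.2 (by simp)) hy hz (by rw [← hv, value_h]; abel)

theorem leftFirst_add {s : State} {p : Part} {y z : Value} (hy : IsOption Left p y)
    (hz : NonNeg z) (hv : s.value + y = z) : LeftFirst (s.value + val p) := by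
  refine leftFirst_of_option (M := p ::ₘ s.parts) (p := p) ?_ (by simp) hy (by simpa [hv])
  rw [value_cons, value_eq, add_comm]

/-- Left wins moving second if Left has an answer to every move of Right. -/
theorem nonNeg
    (hA : ∀ n A', A = n ::ₘ A' → ∀ y, IsOption Right (o (2 * n + 1)) y →
      LeftFirst (value ⟨A', B, C, e, w, k, f, d, h⟩ + y))
    (hB : ∀ n B', B = n ::ₘ B' → ∀ y, IsOption Right (oo (2 * n)) y →
      LeftFirst (value ⟨A, B', C, e, w, k, f, d, h⟩ + y))
    (hC : ∀ n C', C = n ::ₘ C' → ∀ y, IsOption Right (ooEndoo (2 * n + 1)) y →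
      LeftFirst (value ⟨A, B, C', e, w, k, f, d, h⟩ + y))
    (he : ∀ e', e = e' + 1 → LeftFirst (value ⟨A, B, C, e', w, k, f, d + 1, h⟩))
    (hw : ∀ w', w = w' + 1 → LeftFirst (value ⟨A, B, C, e, w', k, f, d, h⟩))
    (hk : ∀ k', k = k' + 1 → ∀ y, IsOption Right (oo 6) y →
      LeftFirst (value ⟨A, B, C, e, w, k', f, d, h⟩ + y))
    (hf : ∀ f', f = f' + 1 → ∀ y, IsOption Right (oo 8) y →
      LeftFirst (value ⟨A, B, C, e, w, k, f', d, h⟩ + y))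
    (hd : ∀ d', d = d' + 1 → LeftFirst (value ⟨A, B, C, e, w, k, f, d', h⟩))
    (hh : ∀ h', h = h' + 1 → LeftFirst (value ⟨A, B, C, e, w, k, f, d, h'⟩))
    (hh1 : ∀ h', h = h' + 1 → LeftFirst (value ⟨A, B, C, e, w, k, f, d + 1, h'⟩))
    (hh2 : ∀ h', h = h' + 1 → LeftFirst (value ⟨A, B, C, e, w + 1, k, f, d, h'⟩)) :
    NonNeg (value ⟨A, B, C, e, w, k, f, d, h⟩) := by
  refine nonNeg_of_options (value_eq _) fun p hp y hy => ?_
  rcases mem_parts.1 hp with ⟨n, hn, rfl⟩ | ⟨n, hn, rfl⟩ | ⟨n, hn, rfl⟩ | ⟨h0, rfl⟩ |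
    ⟨h0, rfl⟩ | ⟨h0, rfl⟩ | ⟨h0, rfl⟩ | ⟨h0, rfl⟩ | ⟨h0, rfl⟩
  · obtain ⟨A', rfl : A = _⟩ := Multiset.exists_cons_of_mem hn
    rw [value_A, valO, add_sub_cancel_right]
    exact hA n A' rfl y hy
  · obtain ⟨A', rfl : B = _⟩ := Multiset.exists_cons_of_mem hn
    rw [value_B, valoO, add_sub_cancel_right]
    exact hB n A' rfl y hy
  · obtain ⟨A', rfl : C = _⟩ := Multiset.exists_cons_of_mem hn
    rw [value_C, valoOo, add_sub_cancel_right]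
    exact hC n A' rfl y hy
  · obtain ⟨n, rfl : e = _⟩ := Nat.exists_eq_succ_of_ne_zero h0
    rw [value_e, add_sub_cancel_right, isOption_right_xxo hy, ← value_d]
    exact he n rfl
  · obtain ⟨n, rfl : w = _⟩ := Nat.exists_eq_succ_of_ne_zero h0
    rw [value_w, val_oo_three, sub_neg_eq_add, sub_add_cancel, isOption_right_oo3 hy, add_zero]
    exact hw n rfl
  · obtain ⟨n, rfl : k = _⟩ := Nat.exists_eq_succ_of_ne_zero h0
    rw [value_k, add_sub_cancel_right]
    exact hk n rfl y hy
  · obtain ⟨n, rfl : f = _⟩ := Nat.exists_eq_succ_of_ne_zero h0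
    rw [value_f, add_sub_cancel_right]
    exact hf n rfl y hy
  · obtain ⟨n, rfl : d = _⟩ := Nat.exists_eq_succ_of_ne_zero h0
    rw [value_d, add_sub_cancel_right, isOption_right_a2 hy, add_zero]
    exact hd n rfl
  · obtain ⟨n, rfl : h = _⟩ := Nat.exists_eq_succ_of_ne_zero h0
    rw [value_h, add_sub_cancel_right]
    rcases isOption_right_a4 hy with rfl | rfl | rfl
    · rw [← sub_eq_add_neg, ← value_w]; exact hh2 n rfl
    · rw [← value_d]; exact hh1 n rfl
    · rw [add_zero]; exact hh n rfl

end

/-! ### Adding parts to a state -/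

theorem val_table {p : Part} {M : List Part} (h : (p, M) ∈ smallTable := by simp [smallTable]) :
    val p = listValue M := tableSound_smallTable (p, M) h

theorem valO_zero : valO 0 = 0 := val_o_one

theorem valoO_one : valoO 1 = 0 := val_oo_two

theorem valoO_two : valoO 2 = val xxo + val (a 2) := by
  change val (oo 4) = _
  simpa using val_table (p := oo 4) (M := [xxo, a 2])

theorem valoOo_one : valoOo 1 = 0 := val_eq_zero_of_notMem (t := .x) (by simp [ooEndoo, alt])

theorem valoOo_two : valoOo 2 = -val xxo := by
  change val (ooEndoo 5) = _
  simpa [val_oo_three] using val_table (p := ooEndoo 5) (M := [oo 3])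

theorem valoOo_three : valoOo 3 = val (a 2) := by
  change val (ooEndoo 7) = _
  simpa using val_table (p := ooEndoo 7) (M := [a 2])

theorem valA_zero : valA 0 = 0 := val_nil

theorem valA_three : valA 3 = 0 := by
  change val (a 6) = _
  simpa using val_table (p := a 6) (M := [])

theorem valA_six : valA 6 = val (a 4) + val (a 2) := by
  change val (a 12) = _
  simpa using val_table (p := a 12) (M := [a 4, a 2])

theorem valoA_zero : valoA 0 = 0 := val_o_one

theorem valoA_one : valoA 1 = -val xxo := val_oo_three

theorem valoA_two : valoA 2 = val (a 2) := by
  change val (oo 5) = _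
  simpa using val_table (p := oo 5) (M := [a 2])

theorem val_a2_add_self : val (a 2) + val (a 2) = 0 := by
  have h : -val (a 2) = val (a 2) := by
    rw [← val_reverse (a 2), ← val_negPart, ← val_reverse]; rfl
  nth_rw 1 [← h]
  exact neg_add_cancel _

theorem val_a4_add_self : val (a 4) + val (a 4) = 0 := by
  have h : -val (a 4) = val (a 4) := by
    rw [← val_reverse (a 4), ← val_negPart, ← val_reverse]; rfl
  nth_rw 1 [← h]
  exact neg_add_cancel _

theorem nsmul_a2 (n : ℕ) : n • val (a 2) = (n % 2) • val (a 2) := by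
  conv_lhs => rw [← Nat.div_add_mod n 2, add_nsmul, mul_nsmul, two_nsmul, val_a2_add_self]
  simp

theorem nsmul_a4 (n : ℕ) : n • val (a 4) = (n % 2) • val (a 4) := by
  conv_lhs => rw [← Nat.div_add_mod n 2, add_nsmul, mul_nsmul, two_nsmul, val_a4_add_self]
  simp

/-- Adds a part `oo (2 * n)` to a state. -/
def addoO (s : State) (n : ℕ) : State :=
  if n = 1 then s else if n = 2 then { s with e := s.e + 1, d := s.d + 1 }
  else if n = 3 then { s with k := s.k + 1 } else if n = 4 then { s with f := s.f + 1 }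
  else { s with B := n ::ₘ s.B }

/-- Adds a part `ooEndoo (2 * n + 1)` to a state. -/
def addoOo (s : State) (n : ℕ) : State :=
  if n = 1 then s else if n = 2 then { s with w := s.w + 1 }
  else if n = 3 then { s with d := s.d + 1 } else { s with C := n ::ₘ s.C }

theorem value_addoO (s : State) (n : ℕ) : (s.addoO n).value = s.value + valoO n := by
  obtain ⟨A, B, C, e, w, k, f, d, h⟩ := s
  unfold addoO
  split_ifs with h1 h2 h3 h4
  · rw [h1, valoO_one, add_zero]
  · rw [h2, valoO_two, value_d, value_e, add_assoc]
  · rw [h3, value_k]; rfl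
  · rw [h4, value_f]; rfl
  · rw [value_B]

theorem value_addoOo (s : State) (n : ℕ) : (s.addoOo n).value = s.value + valoOo n := by
  obtain ⟨A, B, C, e, w, k, f, d, h⟩ := s
  unfold addoOo
  split_ifs with h1 h2 h3
  · rw [h1, valoOo_one, add_zero]
  · rw [h2, valoOo_two, value_w, sub_eq_add_neg]
  · rw [h3, valoOo_three, value_d]
  · rw [value_C]

theorem Valid.addoO {s : State} (hs : s.Valid) {n : ℕ} (hn : 1 ≤ n) : (s.addoO n).Valid := by
  unfold State.addoO
  split_ifs
  on_goal 5 =>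
    refine ⟨hs.hA, fun m hm => ?_, hs.hC⟩
    rcases Multiset.mem_cons.1 hm with rfl | hm
    exacts [by omega, hs.hB m hm]
  all_goals exact ⟨hs.hA, hs.hB, hs.hC⟩

theorem Valid.addoOo {s : State} (hs : s.Valid) {n : ℕ} (hn : 1 ≤ n) : (s.addoOo n).Valid := by
  unfold State.addoOo
  split_ifs
  on_goal 4 =>
    refine ⟨hs.hA, hs.hB, fun m hm => ?_⟩
    rcases Multiset.mem_cons.1 hm with rfl | hm
    exacts [by omega, hs.hC m hm]
  all_goals exact ⟨hs.hA, hs.hB, hs.hC⟩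

theorem weight_addoO (s : State) (n : ℕ) : (s.addoO n).weight ≤ s.weight + 2 * n := by
  unfold State.addoO
  split_ifs <;> simp [weight] <;> omega

theorem weight_addoOo (s : State) (n : ℕ) : (s.addoOo n).weight ≤ s.weight + (2 * n + 1) := by
  unfold State.addoOo
  split_ifs <;> simp [weight] <;> omega

@[simp] theorem A_addoO (s : State) (n : ℕ) : (s.addoO n).A = s.A := by
  unfold State.addoO; split_ifs <;> rfl

@[simp] theorem A_addoOo (s : State) (n : ℕ) : (s.addoOo n).A = s.A := by
  unfold State.addoOo; split_ifs <;> rfl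

theorem numC_addoO (s : State) (n : ℕ) : (s.addoO n).numC ≤ s.numC := by
  unfold State.addoO
  split_ifs <;> simp [numC]
  omega

theorem numC_addoOo (s : State) (n : ℕ) : (s.addoOo n).numC ≤ s.numC + 1 := by
  unfold State.addoOo
  split_ifs <;> simp [numC] <;> omega

theorem robust_addoO (s : State) {n : ℕ} (hn : 2 ≤ n) (hs : s.w ≤ s.e) :
    (s.addoO n).Robust := by
  unfold State.addoO
  split_ifs <;> simp [Robust] <;> omega

/-- Left wins moving first, by the induction hypothesis, if `a (2 * t)` is added. -/
theorem leftFirst_add_valA {N : ℕ}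
    (ih0 : ∀ s : State, s.Valid → s.weight < N → s.Cond0 → LeftFirst s.value)
    (ihA : ∀ (s : State) (t : ℕ), s.Valid → s.weight + 2 * t < N → 4 ≤ t → t ≠ 6 →
      s.numC ≤ s.A.card → LeftFirst (s.value + valA t))
    {s : State} {t : ℕ} (hs : s.Valid) (hN : s.weight + 2 * t < N) (hc : s.numC ≤ s.A.card)
    (hr : s.Robust) : LeftFirst (s.value + valA t) := by
  obtain ⟨A, B, C, e, w, k, f, d, h⟩ := s
  by_cases ht : 4 ≤ t ∧ t ≠ 6
  · exact ihA _ t hs hN ht.1 ht.2 hc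
  have ht' : t = 0 ∨ t = 1 ∨ t = 2 ∨ t = 3 ∨ t = 6 := by omega
  rcases ht' with rfl | rfl | rfl | rfl | rfl
  · rw [valA_zero, add_zero]
    exact ih0 _ hs (by omega) ⟨hc, .inl hr⟩
  · rw [valA, ← value_d]
    exact ih0 _ ⟨hs.1, hs.2, hs.3⟩ (by simp only [weight] at hN ⊢; omega) ⟨hc, .inl hr⟩
  · rw [valA, ← value_h]
    exact ih0 _ ⟨hs.1, hs.2, hs.3⟩ (by simp only [weight] at hN ⊢; omega) ⟨hc, .inl hr⟩
  · rw [valA_three, add_zero]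
    exact ih0 _ hs (by omega) ⟨hc, .inl hr⟩
  · rw [valA_six, ← add_assoc, ← value_h, ← value_d]
    exact ih0 _ ⟨hs.1, hs.2, hs.3⟩ (by simp only [weight] at hN ⊢; omega) ⟨hc, .inl hr⟩

/-- Left wins moving first, by the induction hypothesis, if `oo (2 * t + 1)` is added. -/
theorem leftFirst_add_valoA {N : ℕ}
    (ih0 : ∀ s : State, s.Valid → s.weight < N → s.Cond0 → LeftFirst s.value)
    (ihoA : ∀ (s : State) (t : ℕ), s.Valid → s.weight + (2 * t + 1) < N → 3 ≤ t →
      s.numC + 1 ≤ s.A.card → LeftFirst (s.value + valoA t))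
    {s : State} {t : ℕ} (hs : s.Valid) (hN : s.weight + (2 * t + 1) < N)
    (hc : s.numC + 1 ≤ s.A.card) : LeftFirst (s.value + valoA t) := by
  obtain ⟨A, B, C, e, w, k, f, d, h⟩ := s
  have hr : A.card ≠ 0 := by simp only at hc; omega
  by_cases ht : 3 ≤ t
  · exact ihoA _ t hs hN ht hc
  have ht' : t = 0 ∨ t = 1 ∨ t = 2 := by omega
  rcases ht' with rfl | rfl | rfl
  · rw [valoA_zero, add_zero]
    exact ih0 _ hs (by omega) ⟨by omega, .inl (.inl hr)⟩
  · rw [valoA_one, ← sub_eq_add_neg, ← value_w]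
    exact ih0 _ ⟨hs.1, hs.2, hs.3⟩ (by simp only [weight] at hN ⊢; omega)
      ⟨by simp only [numC] at hc ⊢; omega, .inl (.inl hr)⟩
  · rw [valoA_two, ← value_d]
    exact ih0 _ ⟨hs.1, hs.2, hs.3⟩ (by simp only [weight] at hN ⊢; omega)
      ⟨by simp only [numC] at hc ⊢; omega, .inl (.inl hr)⟩

/-! ### Left wins moving second -/

section

variable {N : ℕ}

theorem leftFirst_right_oo
    (ih0 : ∀ s : State, s.Valid → s.weight < N → s.Cond0 → LeftFirst s.value)
    (ihA : ∀ (s : State) (t : ℕ), s.Valid → s.weight + 2 * t < N → 4 ≤ t → t ≠ 6 →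
      s.numC ≤ s.A.card → LeftFirst (s.value + valA t))
    (ihoA : ∀ (s : State) (t : ℕ), s.Valid → s.weight + (2 * t + 1) < N → 3 ≤ t →
      s.numC + 1 ≤ s.A.card → LeftFirst (s.value + valoA t))
    {s : State} {n : ℕ} (hn : 1 ≤ n) (hs : s.Valid) (hN : s.weight + 2 * n ≤ N)
    (hc : s.numC + 1 ≤ s.A.card) {y : Value} (hy : IsOption Right (oo (2 * n)) y) :
    LeftFirst (s.value + y) := by
  obtain ⟨i, j, hj, hij, rfl | rfl⟩ := isOption_right_oo hn hy
  · rw [add_comm (valoA i), ← add_assoc, ← value_addoO]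
    have h1 := weight_addoO s j
    have h2 := numC_addoO s j
    exact leftFirst_add_valoA ih0 ihoA (hs.addoO hj) (by omega) (by rw [A_addoO]; omega)
  · rw [add_comm (valA i), ← add_assoc, ← value_addoOo]
    have h1 := weight_addoOo s j
    have h2 := numC_addoOo s j
    exact leftFirst_add_valA ih0 ihA (hs.addoOo hj) (by omega) (by rw [A_addoOo]; omega)
      (.inl (by rw [A_addoOo]; omega))

theorem leftFirst_right_ooEndoo
    (ih0 : ∀ s : State, s.Valid → s.weight < N → s.Cond0 → LeftFirst s.value)
    (ihoA : ∀ (s : State) (t : ℕ), s.Valid → s.weight + (2 * t + 1) < N → 3 ≤ t →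
      s.numC + 1 ≤ s.A.card → LeftFirst (s.value + valoA t))
    {s : State} {n : ℕ} (hn : 1 ≤ n) (hs : s.Valid) (hN : s.weight + (2 * n + 1) ≤ N)
    (hc : s.numC + 2 ≤ s.A.card) {y : Value} (hy : IsOption Right (ooEndoo (2 * n + 1)) y) :
    LeftFirst (s.value + y) := by
  obtain ⟨i, j, hj, hij, rfl⟩ := isOption_right_ooEndoo hn hy
  rw [add_comm (valoA i), ← add_assoc, ← value_addoOo]
  have h1 := weight_addoOo s j
  have h2 := numC_addoOo s j
  exact leftFirst_add_valoA ih0 ihoA (hs.addoOo hj) (by omega) (by rw [A_addoOo]; omega)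

/-- A move of Right in a part `o (2 * n + 1)`, where `s` describes the other parts. -/
theorem leftFirst_right_o
    (ih0 : ∀ s : State, s.Valid → s.weight < N → s.Cond0 → LeftFirst s.value)
    (ihA : ∀ (s : State) (t : ℕ), s.Valid → s.weight + 2 * t < N → 4 ≤ t → t ≠ 6 →
      s.numC ≤ s.A.card → LeftFirst (s.value + valA t))
    {s : State} {n : ℕ} (hn : 2 ≤ n ∧ n ≠ 4) (hs : s.Valid) (hN : s.weight + (2 * n + 1) ≤ N)
    (hc : s.numC ≤ s.A.card) (hQ : ¬ IsQ { s with A := n ::ₘ s.A }) {y : Value}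
    (hy : IsOption Right (o (2 * n + 1)) y) : LeftFirst (s.value + y) := by
  obtain ⟨i, j, hi, hij, rfl⟩ := isOption_right_o hy
  rw [← add_assoc, ← value_addoO]
  have h1 := weight_addoO s i
  have h2 := numC_addoO s i
  by_cases hr : (s.addoO i).Robust
  · exact leftFirst_add_valA ih0 ihA (hs.addoO hi) (by omega) (by rw [A_addoO]; omega) hr
  have hw : s.w ≤ s.e := by
    by_contra hw
    refine hr (.inl ?_)
    rw [A_addoO]
    simp only [numC] at hc
    omega
  have hi1 : i = 1 := by
    by_contra hi1
    exact hr (robust_addoO s (by omega) hw)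
  subst hi1
  rw [show s.addoO 1 = s from rfl] at hr ⊢
  by_cases hj : 4 ≤ j ∧ j ≠ 6
  · exact ihA s j hs (by omega) hj.1 hj.2 hc
  obtain ⟨A, B, C, e, w, k, f, d, h⟩ := s
  have hB : B = 0 := by by_contra h; exact hr (by simp [Robust, h])
  have hC : C = 0 := by by_contra h; exact hr (by simp [Robust, h])
  have hA : A = 0 := by by_contra h; exact hr (by simp [Robust, h])
  have he : e = w := by by_contra h; exact hr (by simp [Robust, h])
  have hk : k = 0 := by by_contra h; exact hr (by simp [Robust, h])
  have hf : f = 0 := by by_contra h; exact hr (by simp [Robust, h])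
  subst hB hC hA he hk hf
  have hj' : j = 1 ∨ j = 2 ∨ j = 6 := by omega
  simp only [IsQ] at hQ
  rcases hj' with rfl | rfl | rfl
  · obtain rfl : n = 2 := by omega
    rw [valA, ← value_d]
    exact ih0 _ ⟨hs.1, hs.2, hs.3⟩ (by simp only [weight] at hN ⊢; omega)
      ⟨hc, .inr (by simp at hQ ⊢; omega)⟩
  · obtain rfl : n = 3 := by omega
    rw [valA, ← value_h]
    exact ih0 _ ⟨hs.1, hs.2, hs.3⟩ (by simp only [weight] at hN ⊢; omega)
      ⟨hc, .inr (by simp at hQ ⊢; omega)⟩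
  · obtain rfl : n = 7 := by omega
    rw [valA_six, ← add_assoc, ← value_h, ← value_d]
    exact ih0 _ ⟨hs.1, hs.2, hs.3⟩ (by simp only [weight] at hN ⊢; omega)
      ⟨hc, .inr (by simp at hQ ⊢; omega)⟩

theorem nonNeg_of_cond1 {s : State} (hs : s.Valid) (hc : s.Cond1)
    (ih0 : ∀ s' : State, s'.Valid → s'.weight < s.weight → s'.Cond0 → LeftFirst s'.value)
    (ihA : ∀ (s' : State) (t : ℕ), s'.Valid → s'.weight + 2 * t < s.weight → 4 ≤ t → t ≠ 6 →
      s'.numC ≤ s'.A.card → LeftFirst (s'.value + valA t))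
    (ihoA : ∀ (s' : State) (t : ℕ), s'.Valid → s'.weight + (2 * t + 1) < s.weight → 3 ≤ t →
      s'.numC + 1 ≤ s'.A.card → LeftFirst (s'.value + valoA t)) :
    NonNeg s.value := by
  obtain ⟨A, B, C, e, w, k, f, d, h⟩ := s
  obtain ⟨hc, hQ⟩ := hc
  obtain ⟨hA, hB, hC⟩ := hs
  simp only at hA hB hC
  have hA0 : A.card ≠ 0 := by simp only at hc; omega
  apply nonNeg
  · rintro n A' rfl y hy
    refine leftFirst_right_o ih0 ihA (hA n (by simp))
      ⟨fun m hm => hA m (Multiset.mem_cons_of_mem hm), hB, hC⟩ ?_ ?_ hQ hy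
    · simp [weight]; omega
    · simp [numC] at hc ⊢; omega
  · rintro n B' rfl y hy
    have hn := hB n (by simp)
    refine leftFirst_right_oo ih0 ihA ihoA (by omega)
      ⟨hA, fun m hm => hB m (Multiset.mem_cons_of_mem hm), hC⟩ ?_ ?_ hy
    · simp [weight]; omega
    · simp [numC] at hc ⊢; omega
  · rintro n C' rfl y hy
    have hn := hC n (by simp)
    refine leftFirst_right_ooEndoo ih0 ihoA (by omega)
      ⟨hA, hB, fun m hm => hC m (Multiset.mem_cons_of_mem hm)⟩ ?_ ?_ hy
    · simp [weight]; omega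
    · simp [numC] at hc ⊢; omega
  · rintro m rfl
    exact ih0 _ ⟨hA, hB, hC⟩ (by simp [weight]; omega)
      ⟨by simp [numC] at hc ⊢; omega, .inl (.inl hA0)⟩
  · rintro m rfl
    exact ih0 _ ⟨hA, hB, hC⟩ (by simp [weight])
      ⟨by simp [numC] at hc ⊢; omega, .inl (.inl hA0)⟩
  · rintro m rfl y hy
    refine leftFirst_right_oo (n := 3) ih0 ihA ihoA (by omega) ⟨hA, hB, hC⟩ ?_
      (by simp only [numC] at hc ⊢; exact hc) hy
    simp [weight]; omega
  · rintro m rfl y hy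
    refine leftFirst_right_oo (n := 4) ih0 ihA ihoA (by omega) ⟨hA, hB, hC⟩ ?_
      (by simp only [numC] at hc ⊢; exact hc) hy
    simp [weight]; omega
  all_goals
    rintro m rfl
    refine ih0 _ ⟨hA, hB, hC⟩ (by simp [weight]; try omega)
      ⟨by simp [numC] at hc ⊢; omega, .inl (.inl hA0)⟩

theorem nonNeg_of_cond2 {s : State} (hs : s.Valid) (hc : s.Cond2)
    (ih0 : ∀ s' : State, s'.Valid → s'.weight < s.weight → s'.Cond0 → LeftFirst s'.value) :
    NonNeg s.value := by
  obtain ⟨A, B, C, e, w, k, f, d, h⟩ := s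
  simp only [Cond2, Multiset.card_eq_zero] at hc
  obtain ⟨rfl, rfl, rfl, hew, hc⟩ := hc
  have ih : ∀ e' w' k' f' d' h', w' ≤ e' →
      2 * e' + 2 * w' + 6 * k' + 8 * f' + d' + 4 * h' <
        2 * e + 2 * w + 6 * k + 8 * f + d + 4 * h →
      (e' ≠ w' ∨ k' ≠ 0 ∨ f' ≠ 0 ∨ d' % 2 = 1 ∨ h' % 2 = 1) →
      LeftFirst (value ⟨0, 0, 0, e', w', k', f', d', h'⟩) := by
    intro e' w' k' f' d' h' h1 h2 h3
    refine ih0 _ ⟨hs.1, hs.2, hs.3⟩ (by simpa [weight] using h2) ⟨by simp [numC]; omega, ?_⟩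
    simp only [Robust]
    omega
  apply nonNeg
  · rintro n A' hn
    simp at hn
  · rintro n A' hn
    simp at hn
  · rintro n A' hn
    simp at hn
  · rintro m rfl
    exact ih _ _ _ _ _ _ (by omega) (by omega) (by omega)
  · rintro m rfl
    exact ih _ _ _ _ _ _ (by omega) (by omega) (by omega)
  · rintro m rfl y hy
    obtain ⟨i, j, hj, hij, hy⟩ := isOption_right_oo (n := 3) (by omega) hy
    have : (i = 0 ∧ j = 2) ∨ (i = 1 ∧ j = 1) := by omega
    rcases this with ⟨rfl, rfl⟩ | ⟨rfl, rfl⟩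
    · rcases hy with rfl | rfl
      · rw [valoA_zero, valoO_two, zero_add, ← add_assoc, ← value_e, ← value_d]
        exact ih _ _ _ _ _ _ (by omega) (by omega) (by omega)
      · rw [valA_zero, valoOo_two, zero_add, ← sub_eq_add_neg, ← value_w]
        exact ih _ _ _ _ _ _ (by omega) (by omega) (by omega)
    · rcases hy with rfl | rfl
      · rw [valoA_one, valoO_one, add_zero, ← sub_eq_add_neg, ← value_w]
        exact ih _ _ _ _ _ _ (by omega) (by omega) (by omega)
      · rw [valoOo_one, add_zero, valA, ← value_d]
        exact ih _ _ _ _ _ _ (by omega) (by omega) (by omega)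
  · rintro m rfl y hy
    obtain ⟨i, j, hj, hij, hy⟩ := isOption_right_oo (n := 4) (by omega) hy
    have : (i = 0 ∧ j = 3) ∨ (i = 1 ∧ j = 2) ∨ (i = 2 ∧ j = 1) := by omega
    rcases this with ⟨rfl, rfl⟩ | ⟨rfl, rfl⟩ | ⟨rfl, rfl⟩
    · rcases hy with rfl | rfl
      · rw [valoA_zero, zero_add, valoO, ← value_k]
        exact ih _ _ _ _ _ _ (by omega) (by omega) (by omega)
      · rw [valA_zero, valoOo_three, zero_add, ← value_d]
        exact ih _ _ _ _ _ _ (by omega) (by omega) (by omega)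
    · rcases hy with rfl | rfl
      · rw [valoA_one, valoO_two, neg_add_cancel_left, ← value_d]
        exact ih _ _ _ _ _ _ (by omega) (by omega) (by omega)
      · rw [valoOo_two, valA, ← sub_eq_add_neg, ← add_sub_assoc, ← value_d, ← value_w]
        exact ih _ _ _ _ _ _ (by omega) (by omega) (by omega)
    · rcases hy with rfl | rfl
      · rw [valoA_two, valoO_one, add_zero, ← value_d]
        exact ih _ _ _ _ _ _ (by omega) (by omega) (by omega)
      · rw [valoOo_one, add_zero, valA, ← value_h]
        exact ih _ _ _ _ _ _ (by omega) (by omega) (by omega)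
  all_goals
    rintro m rfl
    exact ih _ _ _ _ _ _ (by omega) (by omega) (by omega)

end

/-! ### Left wins moving first -/

theorem not_isQ_addoO (s : State) {n : ℕ} (hn : 3 ≤ n) : ¬ (s.addoO n).IsQ := by
  intro hq
  have := hq.facts
  unfold State.addoO at this
  rw [if_neg (by omega), if_neg (by omega)] at this
  split_ifs at this <;> simp at this

/-- Left wins moving first if Left is ahead in the number of parts `o (2 * n + 1)`. -/
theorem leftFirst_of_lt {s : State} (hs : s.Valid) (hc : s.numC + 1 ≤ s.A.card)
    (ih : ∀ s' : State, s'.Valid → s'.weight < s.weight → s'.Cond1 ∨ s'.Cond2 →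
      NonNeg s'.value) : LeftFirst s.value := by
  obtain ⟨A, B, C, e, w, k, f, d, h⟩ := s
  obtain ⟨hA, hB, hC⟩ := hs
  simp only at hA hB hC
  simp only [numC] at hc
  by_cases hh : h % 2 = 1
  · obtain ⟨h, rfl⟩ := Nat.exists_eq_succ_of_ne_zero (n := h) (by omega)
    refine leftFirst_h (isOption_a_xxo 0)
      (ih ⟨A, B, C, e + 1, w, k, f, d, h⟩ ⟨hA, hB, hC⟩ (by simp [weight]; omega)
        (.inl ⟨by simp [numC]; omega, fun hq => ?_⟩)) ?_
    · have := hq.facts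
      simp only at this
      omega
    · rw [value_e, valA_zero, add_zero]
  by_cases hk : k ≠ 0
  · obtain ⟨k, rfl⟩ := Nat.exists_eq_succ_of_ne_zero hk
    refine leftFirst_k (isOption_oo_xxo 0)
      (ih ⟨A, B, C, e + 1, w, k, f, d, h⟩ ⟨hA, hB, hC⟩ (by simp [weight]; omega)
        (.inl ⟨by simp [numC]; omega, fun hq => ?_⟩)) ?_
    · have := hq.facts
      simp only at this
      omega
    · rw [value_e, valoO_one, zero_add]
  rw [not_not] at hk
  subst hk
  by_cases hd : d % 2 = 1
  · obtain ⟨d, rfl⟩ := Nat.exists_eq_succ_of_ne_zero (n := d) (by omega)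
    refine leftFirst_d (isOption_a_sub_one 0)
      (ih ⟨A, B, C, e, w, 0, f, d, h⟩ ⟨hA, hB, hC⟩ (by simp [weight])
        (.inl ⟨by simp [numC]; omega, fun hq => ?_⟩)) ?_
    · have := hq.facts
      simp only at this
      omega
    · rw [valA_zero, add_zero]
  rcases lt_trichotomy w e with he | rfl | he
  · obtain ⟨e, rfl⟩ := Nat.exists_eq_succ_of_ne_zero (n := e) (by omega)
    refine leftFirst_e isOption_xxo
      (ih ⟨A, B, C, e, w, 0, f, d, h⟩ ⟨hA, hB, hC⟩ (by simp [weight])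
        (.inl ⟨by simp [numC]; omega, fun hq => ?_⟩)) (add_zero _)
    have := hq.facts
    simp only at this
    omega
  · by_cases hf : f ≠ 0
    · obtain ⟨f, rfl⟩ := Nat.exists_eq_succ_of_ne_zero hf
      refine leftFirst_f (isOption_oo_sub_one 2)
        (ih ⟨A, B, C, w, w, 0 + 1, f, d, h⟩ ⟨hA, hB, hC⟩ (by simp [weight]; omega)
          (.inl ⟨by simp [numC]; omega, fun hq => ?_⟩)) ?_
      · have := hq.facts
        simp only at this
        omega
      · rw [value_k]; rfl
    rw [not_not] at hf
    subst hf
    rcases B.empty_or_exists_mem with rfl | ⟨n, hn⟩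
    swap
    · obtain ⟨B, rfl⟩ := Multiset.exists_cons_of_mem hn
      have hn := hB n (by simp)
      obtain ⟨m, rfl⟩ := Nat.exists_eq_add_of_le' (show 2 ≤ n by omega)
      have hs : Valid ⟨A, B, C, w, w, 0, 0, d, h⟩ :=
        ⟨hA, fun m hm => hB m (Multiset.mem_cons_of_mem hm), hC⟩
      have h1 := weight_addoO ⟨A, B, C, w, w, 0, 0, d, h⟩ (m + 1)
      have h2 := numC_addoO ⟨A, B, C, w, w, 0, 0, d, h⟩ (m + 1)
      refine leftFirst_B (isOption_oo_sub_one m) (ih _ (hs.addoO (n := m + 1) (by omega)) ?_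
        (.inl ⟨?_, not_isQ_addoO _ (by omega)⟩)) (value_addoO _ _).symm
      · simp [weight] at h1 ⊢; omega
      · simp [numC] at h2 hc ⊢; omega
    rcases C.empty_or_exists_mem with rfl | ⟨n, hn⟩
    swap
    · obtain ⟨C, rfl⟩ := Multiset.exists_cons_of_mem hn
      have hn := hC n (by simp)
      obtain ⟨m, rfl⟩ := Nat.exists_eq_add_of_le' (show 2 ≤ n by omega)
      have hs : Valid ⟨A, 0, C, w, w, 0, 0, d + 1, h⟩ :=
        ⟨hA, hB, fun m hm => hC m (Multiset.mem_cons_of_mem hm)⟩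
      have h1 := weight_addoO ⟨A, 0, C, w, w, 0, 0, d + 1, h⟩ (m + 1)
      have h2 := numC_addoO ⟨A, 0, C, w, w, 0, 0, d + 1, h⟩ (m + 1)
      refine leftFirst_C (isOption_ooEndoo m) (ih _ (hs.addoO (n := m + 1) (by omega)) ?_
        (.inl ⟨?_, not_isQ_addoO _ (by omega)⟩)) ?_
      · simp [weight] at h1 ⊢; omega
      · simp [numC] at h2 hc ⊢; omega
      · rw [value_addoO, value_d, add_assoc]
    have hq : ∀ A : Multiset ℕ, ¬ IsQ ⟨A, 0, 0, w, w, 0, 0, d, h⟩ := fun A hq => by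
      have := hq.facts
      simp only at this
      omega
    obtain ⟨n, hn⟩ := Multiset.exists_mem_of_ne_zero
      (show A ≠ 0 by rintro rfl; simp at hc)
    obtain ⟨A, rfl⟩ := Multiset.exists_cons_of_mem hn
    have hn := hA n (by simp)
    have hA' : ∀ m ∈ A, 2 ≤ m ∧ m ≠ 4 := fun m hm => hA m (Multiset.mem_cons_of_mem hm)
    by_cases hn2 : n = 2
    · subst hn2
      refine leftFirst_A (isOption_o_xxo 0)
        (ih ⟨A, 0, 0, w + 1, w, 0, 0, d, h⟩ ⟨hA', hB, hC⟩ (by simp [weight]; omega) ?_) ?_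
      · by_cases hA0 : A.card = 0
        · exact .inr ⟨hA0, rfl, rfl, by simp, .inl (by simp; omega)⟩
        · refine .inl ⟨by simp [numC]; omega, fun hq => ?_⟩
          have := hq.facts
          simp only at this
          omega
      · rw [value_e, valO_zero, add_zero]
    by_cases hn5 : n = 5
    · subst hn5
      refine leftFirst_A (isOption_o_xxo 3)
        (ih ⟨3 ::ₘ A, 0, 0, w + 1, w, 0, 0, d, h⟩ ⟨?_, hB, hC⟩ (by simp [weight]; omega)
          (.inl ⟨by simp [numC], fun hq => ?_⟩)) ?_
      · simpa using hA'
      · have := hq.facts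
        simp only at this
        omega
      · rw [value_e, value_A]; abel
    · obtain ⟨m, rfl⟩ := Nat.exists_eq_add_of_le' (show 1 ≤ n by omega)
      refine leftFirst_A (isOption_o_sub_one m)
        (ih ⟨m ::ₘ A, 0, 0, w, w, 0, 0, d, h⟩ ⟨?_, hB, hC⟩ (by simp [weight])
          (.inl ⟨by simp [numC], hq _⟩)) (value_A m).symm
      simp only [Multiset.mem_cons, forall_eq_or_imp]
      exact ⟨by omega, hA'⟩
  · obtain ⟨w, rfl⟩ := Nat.exists_eq_succ_of_ne_zero (n := w) (by omega)
    refine leftFirst_w isOption_oo3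
      (ih ⟨A, B, C, e, w, 0, f, d + 1, h⟩ ⟨hA, hB, hC⟩ (by simp [weight]; omega)
        (.inl ⟨by simp [numC]; omega, fun hq => ?_⟩)) value_d.symm
    have := hq.facts
    simp only at this
    omega

theorem value_eq_zero {w d h : ℕ} (hd : d % 2 = 0) (hh : h % 2 = 0) :
    value ⟨0, 0, 0, w, w, 0, 0, d, h⟩ = 0 := by
  simp [value, nsmul_a2 d, nsmul_a4 h, hd, hh]

theorem nonNeg_zero_state {w d h : ℕ} (hd : d % 2 = 0) (hh : h % 2 = 0) :
    NonNeg (value ⟨0, 0, 0, w, w, 0, 0, d, h⟩) := by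
  rw [value_eq_zero hd hh]; exact nonNeg_zero

/-- Left wins moving first if a part `oo 3` remains after cancellation. -/
theorem leftFirst_of_oo3 {s : State} (hs : s.Valid) (hc : s.numC = s.A.card) (hw : s.e < s.w)
    (ih : ∀ s' : State, s'.Valid → s'.weight < s.weight → s'.Cond1 ∨ s'.Cond2 →
      NonNeg s'.value) : LeftFirst s.value := by
  obtain ⟨A, B, C, e, w, k, f, d, h⟩ := s
  obtain ⟨hA, hB, hC⟩ := hs
  simp only at hA hB hC hw
  simp only [numC] at hc
  obtain ⟨w, rfl⟩ := Nat.exists_eq_succ_of_ne_zero (n := w) (by omega)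
  by_cases hQ : IsQ ⟨A, B, C, e, w, k, f, d + 1, h⟩
  · simp only [IsQ] at hQ
    obtain ⟨rfl, rfl, rfl, rfl, rfl, ⟨rfl, hd, hh⟩ | ⟨rfl, hd, hh⟩ | ⟨rfl, hd, hh⟩⟩ := hQ
    · refine leftFirst_A (A := 0) (isOption_o_xxo 0)
        (nonNeg_zero_state (w := e + 1) (d := d) (h := h) (by omega) hh) ?_
      rw [valO_zero, add_zero, value_e]
    · obtain ⟨h, rfl⟩ := Nat.exists_eq_succ_of_ne_zero (n := h) (by omega)
      refine leftFirst_h (isOption_a_xxo 0)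
        (ih ⟨{3}, 0, 0, e + 1, e + 1, 0, 0, d, h⟩ ⟨hA, hB, hC⟩ (by simp [weight]; omega)
          (.inl ⟨by simp [numC], fun hq => ?_⟩)) ?_
      · simp [IsQ] at hq
        omega
      · rw [value_e, valA_zero, add_zero]
    · obtain ⟨h, rfl⟩ := Nat.exists_eq_succ_of_ne_zero (n := h) (by omega)
      refine leftFirst_h (isOption_a_xxo 0)
        (ih ⟨{7}, 0, 0, e + 1, e + 1, 0, 0, d, h⟩ ⟨hA, hB, hC⟩ (by simp [weight]; omega)
          (.inl ⟨by simp [numC], fun hq => ?_⟩)) ?_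
      · simp [IsQ] at hq
        omega
      · rw [value_e, valA_zero, add_zero]
  · exact leftFirst_w isOption_oo3
      (ih ⟨A, B, C, e, w, k, f, d + 1, h⟩ ⟨hA, hB, hC⟩ (by simp [weight]; omega)
        (.inl ⟨by simp [numC]; omega, hQ⟩)) value_d.symm

/-- Left wins moving first if there is a part `oo (2 * n)` and no part `o (2 * n + 1)`. -/
theorem leftFirst_of_oo {B : Multiset ℕ} {n e w k f d h : ℕ}
    (hs : Valid ⟨0, n ::ₘ B, 0, e, w, k, f, d, h⟩) (hw : w ≤ e)
    (ih : ∀ s' : State, s'.Valid → s'.weight < weight ⟨0, n ::ₘ B, 0, e, w, k, f, d, h⟩ →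
      s'.Cond1 ∨ s'.Cond2 → NonNeg s'.value) :
    LeftFirst (value ⟨0, n ::ₘ B, 0, e, w, k, f, d, h⟩) := by
  obtain ⟨hA, hB, hC⟩ := hs
  simp only at hA hB hC
  have hn := hB n (by simp)
  have hB' : ∀ m ∈ B, 5 ≤ m := fun m hm => hB m (Multiset.mem_cons_of_mem hm)
  have move_o : ∀ m, n = m + 3 → m ≠ 4 → ¬ IsQ ⟨{m}, B, 0, e, w, k, f, d, h⟩ →
      LeftFirst (value ⟨0, n ::ₘ B, 0, e, w, k, f, d, h⟩) := by
    rintro m rfl h4 hq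
    refine leftFirst_B (isOption_oo_o m) (ih _ ⟨?_, hB', hC⟩ (by simp [weight]; omega)
      (.inl ⟨by simp [numC]; omega, hq⟩)) ?_
    · simp; omega
    · rw [← Multiset.cons_zero, value_A]
  have move_a2_o : ∀ m, n = m + 2 → m ≠ 4 → ¬ IsQ ⟨{m}, B, 0, e, w, k, f, d + 1, h⟩ →
      LeftFirst (value ⟨0, n ::ₘ B, 0, e, w, k, f, d, h⟩) := by
    rintro m rfl h4 hq
    refine leftFirst_B (isOption_oo_a2_o m) (ih _ ⟨?_, hB', hC⟩ (by simp [weight]; omega)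
      (.inl ⟨by simp [numC]; omega, hq⟩)) ?_
    · simp; omega
    · rw [← Multiset.cons_zero, value_A, value_d, add_assoc]
  by_cases h5 : n = 5
  · by_cases hq : IsQ ⟨{2}, B, 0, e, w, k, f, d, h⟩
    · refine move_a2_o 3 h5 (by omega) fun hq' => ?_
      simp [IsQ] at hq hq'
      omega
    · exact move_o 2 h5 (by omega) hq
  by_cases h6 : n = 6
  · by_cases hq : IsQ ⟨{3}, B, 0, e, w, k, f, d, h⟩
    · simp [IsQ] at hq
      obtain ⟨rfl, rfl, rfl, rfl, hq⟩ := hq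
      subst h6
      refine leftFirst_B (isOption_oo_xxo 3)
        (ih ⟨0, 0, 0, e + 1, e, 0, 0 + 1, d, h⟩ ⟨hA, hB', hC⟩ (by simp [weight]; omega)
          (.inr ⟨rfl, rfl, rfl, by simp, .inr (.inr ⟨by simp, hq.2⟩)⟩)) ?_
      rw [value_f, value_e, add_comm (valoO _), add_assoc]; rfl
    · exact move_o 3 h6 (by omega) hq
  by_cases h9 : n = 9
  · refine move_o 6 h9 (by omega) fun hq => ?_
    simp [IsQ] at hq
  · obtain ⟨m, rfl⟩ := Nat.exists_eq_add_of_le' (show 2 ≤ n by omega)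
    refine move_a2_o m rfl (by omega) fun hq => ?_
    simp [IsQ] at hq
    omega

/-- Left wins moving first if the parts are among `xxo`, `oo 3`, `oo 6`, `oo 8`, `a 2`, `a 4`. -/
theorem leftFirst_of_small {e w k f d h : ℕ} (hw : w ≤ e)
    (hne : e ≠ w ∨ k ≠ 0 ∨ f ≠ 0 ∨ d % 2 = 1 ∨ h % 2 = 1)
    (ih : ∀ s' : State, s'.Valid → s'.weight < weight ⟨0, 0, 0, e, w, k, f, d, h⟩ →
      s'.Cond1 ∨ s'.Cond2 → NonNeg s'.value) :
    LeftFirst (value ⟨0, 0, 0, e, w, k, f, d, h⟩) := by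
  have ih' : ∀ e' k' f' d' h', w < e' →
      2 * e' + 6 * k' + 8 * f' + d' + 4 * h' < 2 * e + 6 * k + 8 * f + d + 4 * h →
      (k' + d' % 2 + h' % 2 = 0 ∨ 3 + w ≤ k' + d' % 2 + h' % 2 + e') →
      NonNeg (value ⟨0, 0, 0, e', w, k', f', d', h'⟩) := by
    intro e' k' f' d' h' h1 h2 h3
    refine ih _ ⟨by simp, by simp, by simp⟩ (by simp [weight]; omega)
      (.inr ⟨rfl, rfl, rfl, h1, ?_⟩)
    simp only
    omega
  by_cases hf : f ≠ 0
  · obtain ⟨f, rfl⟩ := Nat.exists_eq_succ_of_ne_zero hf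
    refine leftFirst_f (isOption_oo_xxo 1)
      (ih' (e + 1 + 1) k f (d + 1) h (by omega) (by omega) (by omega)) ?_
    rw [value_d, value_e, value_e, valoO_two]; abel
  rw [not_not] at hf
  subst hf
  by_cases hk : k ≠ 0
  · obtain ⟨k, rfl⟩ := Nat.exists_eq_succ_of_ne_zero hk
    by_cases hx : k + d % 2 + h % 2 = 0 ∨ 3 + w ≤ k + d % 2 + h % 2 + (e + 1)
    · refine leftFirst_k (isOption_oo_xxo 0) (ih' (e + 1) k 0 d h (by omega) (by omega) hx) ?_
      rw [value_e, valoO_one, zero_add]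
    · refine leftFirst_k (isOption_oo_sub_one 1)
        (ih' (e + 1) k 0 (d + 1) h (by omega) (by omega) (by omega)) ?_
      rw [value_d, value_e, valoO_two]; abel
  rw [not_not] at hk
  subst hk
  by_cases hh : h % 2 = 1
  · obtain ⟨h, rfl⟩ := Nat.exists_eq_succ_of_ne_zero (n := h) (by omega)
    by_cases he : e = w
    · subst he
      by_cases hd : d % 2 = 1
      · exact leftFirst_h (isOption_a_sub_one 1)
          (nonNeg_zero_state (w := e) (d := d + 1) (h := h) (by omega) (by omega)) value_d.symm
      · refine leftFirst_h (isOption_a_o 0)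
          (nonNeg_zero_state (w := e) (d := d) (h := h) (by omega) (by omega)) ?_
        rw [valO_zero, add_zero]
    · refine leftFirst_h (isOption_a_xxo 0)
        (ih' (e + 1) 0 0 d h (by omega) (by omega) (by omega)) ?_
      rw [value_e, valA_zero, add_zero]
  by_cases hd : d % 2 = 1
  · obtain ⟨d, rfl⟩ := Nat.exists_eq_succ_of_ne_zero (n := d) (by omega)
    have hopt : value ⟨0, 0, 0, e, w, 0, 0, d, h⟩ + valA 0 = value ⟨0, 0, 0, e, w, 0, 0, d, h⟩ := by
      rw [valA_zero, add_zero]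
    refine leftFirst_d (isOption_a_sub_one 0) ?_ hopt
    by_cases he : e = w
    · subst he
      exact nonNeg_zero_state (by omega) (by omega)
    · exact ih' e 0 0 d h (by omega) (by omega) (by omega)
  obtain ⟨e, rfl⟩ := Nat.exists_eq_succ_of_ne_zero (n := e) (by omega)
  refine leftFirst_e isOption_xxo ?_ (add_zero _)
  by_cases he : e = w
  · subst he
    exact nonNeg_zero_state (by omega) (by omega)
  · exact ih' e 0 0 d h (by omega) (by omega) (by omega)

theorem leftFirst_of_cond0 {s : State} (hs : s.Valid) (hc : s.Cond0)
    (ih : ∀ s' : State, s'.Valid → s'.weight < s.weight → s'.Cond1 ∨ s'.Cond2 →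
      NonNeg s'.value) : LeftFirst s.value := by
  obtain ⟨hc, hne⟩ := hc
  rcases hc.lt_or_eq with hc | hc
  · exact leftFirst_of_lt hs hc ih
  by_cases hw : s.e < s.w
  · exact leftFirst_of_oo3 hs hc hw ih
  obtain ⟨A, B, C, e, w, k, f, d, h⟩ := s
  simp only at hw
  simp only [numC] at hc
  rcases C.empty_or_exists_mem with rfl | ⟨n, hn⟩
  · have hA : A = 0 := by rw [← Multiset.card_eq_zero, ← hc]; simp; omega
    subst hA
    rcases B.empty_or_exists_mem with rfl | ⟨n, hn⟩
    · exact leftFirst_of_small (by omega) (by simp [Robust] at hne; omega) ih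
    · obtain ⟨B, rfl⟩ := Multiset.exists_cons_of_mem hn
      exact leftFirst_of_oo hs (by omega) ih
  · obtain ⟨C, rfl⟩ := Multiset.exists_cons_of_mem hn
    have hn : 4 ≤ n := hs.hC n (by simp)
    obtain ⟨m, rfl⟩ := Nat.exists_eq_add_of_le' (show 2 ≤ n by omega)
    have hs' : Valid ⟨A, B, C, e, w, k, f, d + 1, h⟩ :=
      ⟨hs.hA, hs.hB, fun m hm => hs.hC m (Multiset.mem_cons_of_mem hm)⟩
    have h1 := weight_addoO ⟨A, B, C, e, w, k, f, d + 1, h⟩ (m + 1)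
    have h2 := numC_addoO ⟨A, B, C, e, w, k, f, d + 1, h⟩ (m + 1)
    refine leftFirst_C (isOption_ooEndoo m) (ih _ (hs'.addoO (n := m + 1) (by omega)) ?_
      (.inl ⟨?_, not_isQ_addoO _ (by omega)⟩)) ?_
    · simp [weight] at h1 ⊢; omega
    · simp [numC] at h2 hc ⊢; omega
    · rw [value_addoO, value_d, add_assoc]

theorem leftFirst_add_a {s : State} {t : ℕ} (hs : s.Valid) (ht : 4 ≤ t) (ht' : t ≠ 6)
    (hc : s.numC ≤ s.A.card)
    (ih : ∀ s' : State, s'.Valid → s'.weight < s.weight + 2 * t → s'.Cond1 ∨ s'.Cond2 →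
      NonNeg s'.value) : LeftFirst (s.value + valA t) := by
  obtain ⟨A, B, C, e, w, k, f, d, h⟩ := s
  obtain ⟨hA, hB, hC⟩ := hs
  simp only at hA hB hC
  simp only [numC] at hc
  obtain ⟨m, rfl⟩ := Nat.exists_eq_add_of_le' (show 2 ≤ t by omega)
  by_cases hQ : IsQ ⟨m ::ₘ A, B, C, e, w, k, f, d, h⟩
  · have hQ' := hQ
    have key : ∀ j, m ::ₘ A = {j} ↔ m = j ∧ A = 0 := fun j => by
      rw [eq_comm, Multiset.singleton_eq_cons_iff, eq_comm (a := j)]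
    simp only [IsQ, key] at hQ
    obtain ⟨rfl, rfl, rfl, rfl, rfl, ⟨⟨rfl, rfl⟩, hd, hh⟩ | ⟨⟨rfl, rfl⟩, hd, hh⟩ |
      ⟨⟨rfl, rfl⟩, hd, hh⟩⟩ := hQ
    · refine leftFirst_add (isOption_a_xxo 2)
        (ih ⟨0, 0, 0, e + 1, e, 0, 0, d, h + 1⟩ ⟨hA, hB, hC⟩ (by simp [weight]; omega)
          (.inr ⟨rfl, rfl, rfl, by simp, .inr (.inl (by simp; omega))⟩)) ?_
      rw [value_h, value_e, add_assoc]; rfl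
    · refine leftFirst_add isOption_a10 nonNeg_o5_oo3_a2_a4 ?_
      have e1 : val (oo 4) = val xxo + val (a 2) := valoO_two
      have e2 : -val (a 2) = val (a 2) := neg_eq_of_add_eq_zero_left val_a2_add_self
      have e3 : value ⟨0, 0, 0, e, e, 0, 0, d, h⟩ = val (a 4) := by
        simp [value, nsmul_a2 d, nsmul_a4 h, hd, hh]
      rw [e1, e3, val_oo_three, sub_eq_add_neg, neg_add, e2]
      abel
    · refine leftFirst_add (isOption_a_xxo 7) nonNeg_a14_xxo_a2_a4 ?_
      have e3 : value ⟨0, 0, 0, e, e, 0, 0, d, h⟩ = val (a 2) + val (a 4) := by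
        simp [value, nsmul_a2 d, nsmul_a4 h, hd, hh]
      rw [e3, valA]
      abel
  · refine leftFirst_add (isOption_a_o m)
      (ih ⟨m ::ₘ A, B, C, e, w, k, f, d, h⟩ ⟨?_, hB, hC⟩ (by simp [weight]; omega)
        (.inl ⟨by simp [numC]; omega, hQ⟩)) (value_A m).symm
    simp only [Multiset.mem_cons, forall_eq_or_imp]
    exact ⟨by omega, hA⟩

theorem leftFirst_add_oo_odd {s : State} {t : ℕ} (hs : s.Valid) (ht : 3 ≤ t)
    (hc : s.numC + 1 ≤ s.A.card)
    (ih : ∀ s' : State, s'.Valid → s'.weight < s.weight + (2 * t + 1) → s'.Cond1 ∨ s'.Cond2 →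
      NonNeg s'.value) : LeftFirst (s.value + valoA t) := by
  obtain ⟨m, rfl⟩ := Nat.exists_eq_add_of_le' (show 2 ≤ t by omega)
  have h1 := weight_addoO s (m + 1)
  have h2 := numC_addoO s (m + 1)
  refine leftFirst_add (isOption_oo_odd m) (ih _ (hs.addoO (n := m + 1) (by omega)) (by omega)
    (.inl ⟨by rw [A_addoO]; omega, ?_⟩)) (value_addoO _ _).symm
  by_cases hm : m = 1
  · subst hm
    intro hq
    have := hq.facts
    simp [addoO] at this
    simp only [numC] at hc
    omega
  · exact not_isQ_addoO _ (by omega)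

/-! ### The induction -/

theorem induction_step (N : ℕ) :
    (∀ s : State, s.Valid → s.weight ≤ N → s.Cond1 ∨ s.Cond2 → NonNeg s.value) ∧
    (∀ s : State, s.Valid → s.weight ≤ N → s.Cond0 → LeftFirst s.value) ∧
    (∀ (s : State) (t : ℕ), s.Valid → s.weight + 2 * t ≤ N → 4 ≤ t → t ≠ 6 →
      s.numC ≤ s.A.card → LeftFirst (s.value + valA t)) ∧
    (∀ (s : State) (t : ℕ), s.Valid → s.weight + (2 * t + 1) ≤ N → 3 ≤ t →
      s.numC + 1 ≤ s.A.card → LeftFirst (s.value + valoA t)) := by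
  induction N using Nat.strong_induction_on with
  | _ N ih =>
    have ihN : ∀ s : State, s.Valid → s.weight < N → s.Cond1 ∨ s.Cond2 → NonNeg s.value :=
      fun s hs hN => (ih _ hN).1 s hs le_rfl
    have ih0 : ∀ s : State, s.Valid → s.weight < N → s.Cond0 → LeftFirst s.value :=
      fun s hs hN => (ih _ hN).2.1 s hs le_rfl
    refine ⟨fun s hs hN hc => ?_, fun s hs hN hc => ?_, fun s t hs hN ht ht' hc => ?_,
      fun s t hs hN ht hc => ?_⟩
    · rcases hc with hc | hc
      · exact nonNeg_of_cond1 hs hc (fun s' hs' h => ih0 s' hs' (h.trans_le hN))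
          (fun s' t hs' h => (ih _ (h.trans_le hN)).2.2.1 s' t hs' le_rfl)
          (fun s' t hs' h => (ih _ (h.trans_le hN)).2.2.2 s' t hs' le_rfl)
      · exact nonNeg_of_cond2 hs hc fun s' hs' h => ih0 s' hs' (h.trans_le hN)
    · exact leftFirst_of_cond0 hs hc fun s' hs' h => ihN s' hs' (h.trans_le hN)
    · exact leftFirst_add_a hs ht ht' hc fun s' hs' h => ihN s' hs' (h.trans_le hN)
    · exact leftFirst_add_oo_odd hs ht hc fun s' hs' h => ihN s' hs' (h.trans_le hN)

end State

/-! ### Rows and their states -/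

theorem value_parts (g : Row) : value (parts g) = value (blocks g) := by
  have key : ∀ L : List Part, value ((L.filter fun p => !p.isEmpty : List Part) : Multiset Part) =
      value (L : Multiset Part) := by
    intro L
    induction L with
    | nil => rfl
    | cons p L ih =>
      cases p with
      | nil =>
        rw [← Multiset.cons_coe, value_cons, val_nil, zero_add, ← ih]
        rfl
      | cons c p =>
        rw [← Multiset.cons_coe, value_cons, ← ih, ← value_cons]
        rfl
  exact key _

theorem winsFirst_left_iff (g : Row) : WinsFirst Left g ↔ LeftFirst (value (parts g)) := by
  rw [value_parts, leftFirst_value, winsFirst_iff]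

theorem winsFirst_right_iff (g : Row) : WinsFirst Right g ↔ ¬ NonNeg (value (parts g)) := by
  rw [value_parts, nonNeg_value, not_not, winsFirst_iff]

theorem SamePart.symm {p q : Part} (h : SamePart p q) : SamePart q p := by
  rcases h with rfl | rfl
  · exact .inl rfl
  · exact .inr (List.reverse_reverse q).symm

theorem SamePart.trans {p q r : Part} (h : SamePart p q) (h' : SamePart q r) : SamePart p r := by
  rcases h with rfl | rfl
  · exact h'
  · rcases h' with rfl | rfl
    · exact .inr rfl
    · exact .inl (List.reverse_reverse r)

theorem SameParts.value_eq {M N : Multiset Part} (h : SameParts M N) : value M = value N := by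
  induction h with
  | zero => rfl
  | cons hp _ ih => rw [value_cons, value_cons, ih, hp.val_eq]

/-- In a position in standard form no two parts cancel. -/
theorem IsStandardForm.not_cancel {g : Row} (hg : IsStandardForm g) {p q : Part}
    {N : Multiset Part} (hpq : SamePart q (negPart p))
    (h : SameParts (parts g) (p ::ₘ q ::ₘ N)) : False := by
  rw [show p ::ₘ q ::ₘ N = {p, q} + N by simp] at h
  obtain ⟨M, C, hM, -, hMC⟩ := Multiset.rel_add_right.1 h
  refine hg (0 + C) ⟨_, _, M, C, .beta p, ?_, hMC, rfl⟩
  rw [show ({p, q} : Multiset Part) = p ::ₘ q ::ₘ 0 from rfl, Multiset.rel_cons_right] at hM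
  obtain ⟨p', M', hp', hM', rfl⟩ := hM
  rw [Multiset.rel_cons_right] at hM'
  obtain ⟨q', M'', hq', hM'', rfl⟩ := hM'
  rw [Multiset.rel_zero_right] at hM''
  subst hM''
  exact .cons hp' (.cons (hq'.trans hpq) .zero)

/-! ### The kinds of parts -/

theorem count_alt_even (t : ℕ) :
    (alt .o (2 * t)).count .o = t ∧ (alt .o (2 * t)).count .x = t := by
  induction t with
  | zero => simp [alt]
  | succ t ih =>
    rw [show 2 * (t + 1) = 2 * t + 1 + 1 by ring]
    simp [alt, ih]

theorem count_alt_odd (t : ℕ) :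
    (alt .o (2 * t + 1)).count .o = t + 1 ∧ (alt .o (2 * t + 1)).count .x = t := by
  rw [alt_two_mul_add]
  simp [alt, count_alt_even]

theorem isChain_alt (c : Color) (n : ℕ) : (alt c n).IsChain (· ≠ ·) := by
  induction n generalizing c with
  | zero => exact .nil
  | succ n ih =>
    cases n with
    | zero => exact .singleton _
    | succ n => exact .cons_cons (by cases c <;> simp) (ih c.opp)

open Classical in
/-- The position of the set a part of `setK` belongs to in the list `setO'`, `setoO'`, `setoOo'`,
`setI`, `setXxo`, `setOo8`, `setA'`, `setoA'`. -/
noncomputable def kind (p : Part) : ℕ :=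
  if p.count .o = p.count .x then (if 4 ≤ p.count .o then 6 else 3)
  else if p.count .o = p.count .x + 2 then
    (if 6 ≤ p.count .o then 1 else if p.count .o = 4 then 3 else 5)
  else if p.count .x = p.count .o + 1 then 4
  else if p.count .o = p.count .x + 3 then 2
  else if p.count .o = 2 then 2
  else if p.IsChain (· ≠ ·) then 0 else 7

theorem kind_reverse (p : Part) : kind p.reverse = kind p := by
  have : p.reverse.IsChain (· ≠ ·) ↔ p.IsChain (· ≠ ·) := by
    rw [List.isChain_reverse]
    simp only [ne_comm]
  simp only [kind, List.count_reverse, this]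

theorem SamePart.kind_eq {p q : Part} (h : SamePart p q) : kind p = kind q := by
  rcases h with rfl | rfl
  exacts [rfl, kind_reverse q]

theorem kind_o {t : ℕ} (ht : 2 ≤ t) : kind (o (2 * t + 1)) = 0 := by
  have h := count_alt_odd t
  rw [kind, o, h.1, h.2, if_neg (by omega), if_neg (by omega), if_neg (by omega),
    if_neg (by omega), if_neg (by omega), if_pos (isChain_alt _ _)]

theorem count_oo_even {t : ℕ} (ht : 1 ≤ t) :
    (oo (2 * t)).count .o = t + 1 ∧ (oo (2 * t)).count .x = t - 1 := by
  obtain ⟨t, rfl⟩ := Nat.exists_eq_add_of_le' ht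
  have h := count_alt_odd t
  rw [show oo (2 * (t + 1)) = .o :: alt .o (2 * t + 1) from rfl]
  simp [h]

theorem kind_oo {t : ℕ} (ht : 5 ≤ t) : kind (oo (2 * t)) = 1 := by
  have h := count_oo_even (t := t) (by omega)
  rw [kind, h.1, h.2, if_neg (by omega), if_pos (by omega), if_pos (by omega)]

theorem kind_oo6 : kind (oo 6) = 3 := by
  have h := count_oo_even (t := 3) (by omega)
  rw [kind, h.1, h.2]; simp

theorem kind_oo8 : kind (oo 8) = 5 := by
  have h := count_oo_even (t := 4) (by omega)
  rw [kind, h.1, h.2]; simp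

theorem kind_ooEndoo {t : ℕ} (ht : 4 ≤ t) : kind (ooEndoo (2 * t + 1)) = 2 := by
  obtain ⟨t, rfl⟩ := Nat.exists_eq_add_of_le' (show 1 ≤ t by omega)
  have h := count_alt_odd t
  have h' : (ooEndoo (2 * (t + 1) + 1)).count .o = t + 3 ∧
      (ooEndoo (2 * (t + 1) + 1)).count .x = t := by
    rw [show ooEndoo (2 * (t + 1) + 1) = .o :: (alt .o (2 * t + 1) ++ [.o]) from rfl]
    simp [h]
  rw [kind, h'.1, h'.2, if_neg (by omega), if_neg (by omega), if_neg (by omega), if_pos rfl]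

theorem kind_oo3 : kind (oo 3) = 2 := by
  have h : (oo 3).count .o = 2 ∧ (oo 3).count .x = 1 := by decide
  rw [kind, h.1, h.2]; simp

theorem kind_xxo : kind xxo = 4 := by
  have h : xxo.count .o = 1 ∧ xxo.count .x = 2 := by decide
  rw [kind, h.1, h.2]; simp

theorem kind_a2 : kind (a 2) = 3 := by
  have h := count_alt_even 1
  rw [kind, a, h.1, h.2]; simp

theorem kind_a4 : kind (a 4) = 3 := by
  have h := count_alt_even 2
  rw [kind, a, h.1, h.2]; simp

theorem kind_a {t : ℕ} (ht : 4 ≤ t) : kind (a (2 * t)) = 6 := by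
  have h := count_alt_even t
  rw [kind, a, h.1, h.2, if_pos rfl, if_pos ht]

theorem kind_oo_odd {t : ℕ} (ht : 3 ≤ t) : kind (oo (2 * t + 1)) = 7 := by
  have h := count_alt_even t
  have h' : (oo (2 * t + 1)).count .o = t + 1 ∧ (oo (2 * t + 1)).count .x = t := by
    simp [oo, h]
  have hc : ¬ (oo (2 * t + 1)).IsChain (· ≠ ·) := by
    obtain ⟨t, rfl⟩ := Nat.exists_eq_add_of_le' (show 1 ≤ t by omega)
    rw [show oo (2 * (t + 1) + 1) = .o :: .o :: alt .x (2 * t + 1) from rfl]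
    simp
  rw [kind, h'.1, h'.2, if_neg (by omega), if_neg (by omega), if_neg (by omega),
    if_neg (by omega), if_neg (by omega), if_neg hc]

/-- The sets of parts that make up `setK`. -/
def setOfKind : ℕ → Set Part
  | 0 => setO'
  | 1 => setoO'
  | 2 => setoOo'
  | 3 => setI
  | 4 => setXxo
  | 5 => setOo8
  | 6 => setA'
  | 7 => setoA'
  | _ => ∅

theorem mem_setK_iff {p : Part} : p ∈ setK ↔ ∃ i, p ∈ setOfKind i := by
  constructor
  · rintro (((((((h | h) | h) | h) | h) | h) | h) | h)
    exacts [⟨0, h⟩, ⟨1, h⟩, ⟨2, h⟩, ⟨3, h⟩, ⟨4, h⟩, ⟨5, h⟩, ⟨6, h⟩, ⟨7, h⟩]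
  · rintro ⟨i, h⟩
    match i, h with
    | 0, h => exact .inl (.inl (.inl (.inl (.inl (.inl (.inl h))))))
    | 1, h => exact .inl (.inl (.inl (.inl (.inl (.inl (.inr h))))))
    | 2, h => exact .inl (.inl (.inl (.inl (.inl (.inr h)))))
    | 3, h => exact .inl (.inl (.inl (.inl (.inr h))))
    | 4, h => exact .inl (.inl (.inl (.inr h)))
    | 5, h => exact .inl (.inl (.inr h))
    | 6, h => exact .inl (.inr h)
    | 7, h => exact .inr h
    | _ + 8, h => exact h.elim

theorem kind_eq_of_mem {p : Part} {i : ℕ} (h : p ∈ setOfKind i) : kind p = i := by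
  match i, h with
  | 0, ⟨q, ⟨t, h1, h2, hq⟩, h⟩ => rw [h.kind_eq, hq, kind_o h1]
  | 1, ⟨q, ⟨t, h1, hq⟩, h⟩ => rw [h.kind_eq, hq, kind_oo h1]
  | 2, ⟨q, hq, h⟩ =>
    rcases hq with hq | ⟨t, h1, hq⟩
    · rw [h.kind_eq, hq, kind_oo3]
    · rw [h.kind_eq, hq, kind_ooEndoo h1]
  | 3, ⟨q, hq, h⟩ =>
    rcases hq with hq | hq | hq
    · rw [h.kind_eq, hq, kind_a2]
    · rw [h.kind_eq, hq, kind_a4]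
    · rw [h.kind_eq, hq, kind_oo6]
  | 4, ⟨q, hq, h⟩ => rw [h.kind_eq, hq, kind_xxo]
  | 5, ⟨q, hq, h⟩ => rw [h.kind_eq, hq, kind_oo8]
  | 6, ⟨q, ⟨t, h1, h2, hq⟩, h⟩ => rw [h.kind_eq, hq, kind_a h1]
  | 7, ⟨q, ⟨t, h1, hq⟩, h⟩ => rw [h.kind_eq, hq, kind_oo_odd h1]
  | _ + 8, h => exact h.elim

theorem numParts_setOfKind {g : Row} (hg : ∀ p ∈ parts g, p ∈ setK) (i : ℕ) :
    numParts (setOfKind i) g = (parts g).countP (fun p => kind p = i) := by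
  classical
  refine Multiset.countP_congr rfl fun p hp => ?_
  obtain ⟨j, hj⟩ := mem_setK_iff.1 (hg p hp)
  rw [kind_eq_of_mem hj]
  refine propext ⟨fun h => ?_, ?_⟩
  · rw [← kind_eq_of_mem hj, kind_eq_of_mem h]
  · rintro rfl
    exact hj

/-- Collections of parts from `setK` are described by states, up to parts `a (2 * t)` and
`oo (2 * t + 1)`. -/
theorem exists_state (M : Multiset Part) (hM : ∀ p ∈ M, p ∈ setK) :
    ∃ (s : State) (Y Z : Multiset ℕ), s.Valid ∧ (∀ t ∈ Y, 4 ≤ t ∧ t ≠ 6) ∧ (∀ t ∈ Z, 3 ≤ t) ∧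
      SameParts M (s.parts + Y.map (fun t => a (2 * t)) + Z.map (fun t => oo (2 * t + 1))) ∧
      M.countP (fun p => kind p = 0) = s.A.card ∧ M.countP (fun p => kind p = 1) = s.B.card ∧
      M.countP (fun p => kind p = 2) = s.C.card + s.w ∧
      M.countP (fun p => kind p = 3) = s.k + s.d + s.h ∧ M.countP (fun p => kind p = 4) = s.e ∧
      M.countP (fun p => kind p = 5) = s.f ∧ M.countP (fun p => kind p = 6) = Y.card ∧
      M.countP (fun p => kind p = 7) = Z.card := by
  induction M using Multiset.induction_on with
  | empty =>
    exact ⟨⟨0, 0, 0, 0, 0, 0, 0, 0, 0⟩, 0, 0, ⟨by simp, by simp, by simp⟩, by simp, by simp,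
      by simp [State.parts]; exact .zero, by simp⟩
  | cons p M ih =>
    obtain ⟨⟨A, B, C, e, w, k, f, d, h⟩, Y, Z, ⟨hA, hB, hC⟩, hY, hZ, hS, hc⟩ :=
      ih fun q hq => hM q (Multiset.mem_cons_of_mem hq)
    simp only at hA hB hC hc
    obtain ⟨i, hi⟩ := mem_setK_iff.1 (hM p (by simp))
    have hk := kind_eq_of_mem hi
    have step : ∀ {q : Part} {N : Multiset Part}, SamePart p q →
        N = q ::ₘ (State.parts ⟨A, B, C, e, w, k, f, d, h⟩ + Y.map (fun t => a (2 * t)) +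
          Z.map (fun t => oo (2 * t + 1))) → SameParts (p ::ₘ M) N := by
      rintro q N hq rfl
      exact .cons hq hS
    match i, hi with
    | 0, ⟨q, ⟨t, h1, h2, hq⟩, hpq⟩ =>
      refine ⟨⟨t ::ₘ A, B, C, e, w, k, f, d, h⟩, Y, Z, ⟨?_, hB, hC⟩, hY, hZ, ?_, ?_⟩
      · simpa [h1, h2] using hA
      · exact step (hq ▸ hpq) (by simp [State.parts])
      · simp [hk, hc]
    | 1, ⟨q, ⟨t, h1, hq⟩, hpq⟩ =>
      refine ⟨⟨A, t ::ₘ B, C, e, w, k, f, d, h⟩, Y, Z, ⟨hA, ?_, hC⟩, hY, hZ, ?_, ?_⟩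
      · simpa [h1] using hB
      · exact step (hq ▸ hpq) (by simp [State.parts])
      · simp [hk, hc]
    | 2, ⟨q, hq, hpq⟩ =>
      rcases hq with hq | ⟨t, h1, hq⟩
      · refine ⟨⟨A, B, C, e, w + 1, k, f, d, h⟩, Y, Z, ⟨hA, hB, hC⟩, hY, hZ, ?_, ?_⟩
        · exact step (hq ▸ hpq) (by simp [State.parts, Multiset.replicate_succ])
        · simp [hk, hc]; omega
      · refine ⟨⟨A, B, t ::ₘ C, e, w, k, f, d, h⟩, Y, Z, ⟨hA, hB, ?_⟩, hY, hZ, ?_, ?_⟩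
        · simpa [h1] using hC
        · exact step (hq ▸ hpq) (by simp [State.parts])
        · simp [hk, hc]; omega
    | 3, ⟨q, hq, hpq⟩ =>
      rcases hq with hq | hq | hq
      · refine ⟨⟨A, B, C, e, w, k, f, d + 1, h⟩, Y, Z, ⟨hA, hB, hC⟩, hY, hZ, ?_, ?_⟩
        · exact step (hq ▸ hpq) (by simp [State.parts, Multiset.replicate_succ])
        · simp [hk, hc]; omega
      · refine ⟨⟨A, B, C, e, w, k, f, d, h + 1⟩, Y, Z, ⟨hA, hB, hC⟩, hY, hZ, ?_, ?_⟩
        · exact step (hq ▸ hpq) (by simp [State.parts, Multiset.replicate_succ])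
        · simp [hk, hc]; omega
      · refine ⟨⟨A, B, C, e, w, k + 1, f, d, h⟩, Y, Z, ⟨hA, hB, hC⟩, hY, hZ, ?_, ?_⟩
        · exact step (hq ▸ hpq) (by simp [State.parts, Multiset.replicate_succ])
        · simp [hk, hc]; omega
    | 4, ⟨q, hq, hpq⟩ =>
      refine ⟨⟨A, B, C, e + 1, w, k, f, d, h⟩, Y, Z, ⟨hA, hB, hC⟩, hY, hZ, ?_, ?_⟩
      · exact step (hq ▸ hpq) (by simp [State.parts, Multiset.replicate_succ])
      · simp [hk, hc]
    | 5, ⟨q, hq, hpq⟩ =>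
      refine ⟨⟨A, B, C, e, w, k, f + 1, d, h⟩, Y, Z, ⟨hA, hB, hC⟩, hY, hZ, ?_, ?_⟩
      · exact step (hq ▸ hpq) (by simp [State.parts, Multiset.replicate_succ])
      · simp [hk, hc]
    | 6, ⟨q, ⟨t, h1, h2, hq⟩, hpq⟩ =>
      refine ⟨⟨A, B, C, e, w, k, f, d, h⟩, t ::ₘ Y, Z, ⟨hA, hB, hC⟩, ?_, hZ, ?_, ?_⟩
      · simpa [h1, h2] using hY
      · exact step (hq ▸ hpq) (by simp)
      · simp [hk, hc]
    | 7, ⟨q, ⟨t, h1, hq⟩, hpq⟩ =>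
      refine ⟨⟨A, B, C, e, w, k, f, d, h⟩, Y, t ::ₘ Z, ⟨hA, hB, hC⟩, hY, ?_, ?_, ?_⟩
      · simpa [h1] using hZ
      · exact step (hq ▸ hpq) (by simp)
      · simp [hk, hc]
    | _ + 8, hi => exact hi.elim

/-- The state of an admissible position. -/
theorem Admissible.exists_state {g : Row} (hg : Admissible g) :
    ∃ (s : State) (Y Z : Multiset ℕ), s.Valid ∧ (∀ t ∈ Y, 4 ≤ t ∧ t ≠ 6) ∧ (∀ t ∈ Z, 3 ≤ t) ∧
      value (parts g) = s.value + (Y.map valA).sum + (Z.map valoA).sum ∧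
      numParts setO' g = s.A.card ∧ numParts setoO' g = s.B.card ∧
      numParts setoOo' g = s.C.card + s.w ∧ numParts setI g = s.k + s.d + s.h ∧
      numParts setXxo g = s.e ∧ numParts setA' g = Y.card ∧ numParts setoA' g = Z.card ∧
      s.d ≤ 1 ∧ s.h ≤ 1 ∧ (s.e = 0 ∨ s.w = 0) ∧
      (Y = 0 → Z = 0 → (s.IsQ → Q g) ∧ (s.Robust ∨ s.d % 2 = 1 ∨ s.h % 2 = 1)) := by
  obtain ⟨hst, hK, hne⟩ := hg
  obtain ⟨s, Y, Z, hs, hY, hZ, hS, h0, h1, h2, h3, h4, h5, h6, h7⟩ := Clobber.exists_state _ hK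
  have hcount := numParts_setOfKind hK
  obtain ⟨A, B, C, e, w, k, f, d, h⟩ := s
  have hd : d ≤ 1 := by
    by_contra hd
    obtain ⟨d, rfl⟩ := Nat.exists_eq_add_of_le' (show 2 ≤ d by omega)
    refine hst.not_cancel (p := a 2) (q := a 2)
      (N := State.parts ⟨A, B, C, e, w, k, f, d, h⟩ + Y.map (fun t => a (2 * t)) +
        Z.map (fun t => oo (2 * t + 1))) (.inr rfl) ?_
    convert hS using 1
    simp [State.parts, Multiset.replicate_succ]
  have hh : h ≤ 1 := by
    by_contra hd
    obtain ⟨h, rfl⟩ := Nat.exists_eq_add_of_le' (show 2 ≤ h by omega)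
    refine hst.not_cancel (p := a 4) (q := a 4)
      (N := State.parts ⟨A, B, C, e, w, k, f, d, h⟩ + Y.map (fun t => a (2 * t)) +
        Z.map (fun t => oo (2 * t + 1))) (.inr rfl) ?_
    convert hS using 1
    simp [State.parts, Multiset.replicate_succ]
  have hew : e = 0 ∨ w = 0 := by
    by_contra hd
    obtain ⟨e, rfl⟩ := Nat.exists_eq_add_of_le' (show 1 ≤ e by omega)
    obtain ⟨w, rfl⟩ := Nat.exists_eq_add_of_le' (show 1 ≤ w by omega)
    refine hst.not_cancel (p := xxo) (q := oo 3)
      (N := State.parts ⟨A, B, C, e, w, k, f, d, h⟩ + Y.map (fun t => a (2 * t)) +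
        Z.map (fun t => oo (2 * t + 1))) (.inl rfl) ?_
    convert hS using 1
    simpa [State.parts, Multiset.replicate_succ] using Multiset.cons_swap _ _ _
  refine ⟨_, Y, Z, hs, hY, hZ, ?_, (hcount 0).trans h0, (hcount 1).trans h1,
    (hcount 2).trans h2, (hcount 3).trans h3, (hcount 4).trans h4, (hcount 6).trans h6,
    (hcount 7).trans h7, hd, hh, hew, ?_⟩
  · rw [hS.value_eq, map_add, map_add, State.value_eq, value_eq_sum (Y.map _),
      value_eq_sum (Z.map _), Multiset.map_map, Multiset.map_map]
    rfl
  rintro rfl rfl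
  simp only [Multiset.map_zero, add_zero] at hS
  constructor
  · rintro ⟨hB, hC, he, hk, hf, hq⟩
    simp only at hB hC he hk hf hq
    obtain ⟨rfl, rfl⟩ : e = 0 ∧ w = 0 := by omega
    subst hB hC hk hf
    rcases hq with ⟨rfl, h1, h2⟩ | ⟨rfl, h1, h2⟩ | ⟨rfl, h1, h2⟩
    · obtain ⟨rfl, rfl⟩ : d = 1 ∧ h = 0 := by omega
      refine .inl ?_
      simpa [State.parts] using hS
    · obtain ⟨rfl, rfl⟩ : d = 0 ∧ h = 1 := by omega
      refine .inr (.inl ?_)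
      simpa [State.parts] using hS
    · obtain ⟨rfl, rfl⟩ : d = 1 ∧ h = 1 := by omega
      refine .inr (.inr ?_)
      convert hS using 1
      simp only [State.parts]
      simpa using Multiset.pair_comm (a 4) (a 2)
  · by_contra hcon
    simp only [State.Robust, ne_eq, Multiset.card_eq_zero] at hcon
    push Not at hcon
    obtain ⟨⟨rfl, rfl, rfl, he, rfl, rfl⟩, hd', hh'⟩ := hcon
    obtain ⟨rfl, rfl, rfl, rfl⟩ : e = 0 ∧ w = 0 ∧ d = 0 ∧ h = 0 := by omega
    rw [show State.parts ⟨0, 0, 0, 0, 0, 0, 0, 0, 0⟩ = 0 by simp [State.parts]] at hS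
    exact hne (Multiset.rel_zero_right.1 hS)

theorem State.nonNeg_of_cond {s : State} (hs : s.Valid) (hc : s.Cond1 ∨ s.Cond2) :
    NonNeg s.value := (State.induction_step s.weight).1 s hs le_rfl hc

theorem State.leftFirst_of_cond {s : State} (hs : s.Valid) (hc : s.Cond0) :
    LeftFirst s.value := (State.induction_step s.weight).2.1 s hs le_rfl hc

theorem State.leftFirst_add_valA_of_le {s : State} {t : ℕ} (hs : s.Valid) (ht : 4 ≤ t)
    (ht' : t ≠ 6) (hc : s.numC ≤ s.A.card) : LeftFirst (s.value + valA t) :=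
  (State.induction_step (s.weight + 2 * t)).2.2.1 s t hs le_rfl ht ht' hc

theorem State.leftFirst_add_valoA_of_lt {s : State} {t : ℕ} (hs : s.Valid) (ht : 3 ≤ t)
    (hc : s.numC + 1 ≤ s.A.card) : LeftFirst (s.value + valoA t) :=
  (State.induction_step (s.weight + (2 * t + 1))).2.2.2 s t hs le_rfl ht hc

theorem outcomeL_or_outcomeN_of_S0 {g : Row} (hg : S0 g) : OutcomeL g ∨ OutcomeN g := by
  suffices h : WinsFirst Left g by
    by_cases hR : WinsFirst Right g
    exacts [.inr ⟨h, hR⟩, .inl ⟨h, hR⟩]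
  obtain ⟨hadm, hg⟩ := hg
  obtain ⟨s, Y, Z, hs, hY, hZ, hv, h0, -, h2, -, -, h6, h7, -, -, -, hYZ⟩ := hadm.exists_state
  rw [h0, h2, h6, h7] at hg
  rw [winsFirst_left_iff, hv]
  rcases hg with ⟨hy, hz, hc⟩ | ⟨hy, hz, hc⟩ | ⟨hy, hz, hc⟩
  · rw [Multiset.card_eq_zero] at hz
    obtain ⟨t, rfl⟩ := Multiset.card_eq_one.1 hy
    obtain ⟨ht, ht'⟩ := hY t (by simp)
    rw [hz, Multiset.map_zero, Multiset.sum_zero, add_zero, Multiset.map_singleton,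
      Multiset.sum_singleton]
    exact State.leftFirst_add_valA_of_le hs ht ht' (by simp only [State.numC]; omega)
  · rw [Multiset.card_eq_zero] at hy hz
    obtain ⟨-, hr⟩ := hYZ hy hz
    rw [hy, hz, Multiset.map_zero, Multiset.map_zero, Multiset.sum_zero, add_zero, add_zero]
    exact State.leftFirst_of_cond hs ⟨by simp only [State.numC]; omega, hr⟩
  · rw [Multiset.card_eq_zero] at hy
    obtain ⟨t, rfl⟩ := Multiset.card_eq_one.1 hz
    rw [hy, Multiset.map_zero, Multiset.sum_zero, add_zero, Multiset.map_singleton,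
      Multiset.sum_singleton]
    exact State.leftFirst_add_valoA_of_lt hs (hZ t (by simp)) (by simp only [State.numC]; omega)

theorem outcomeL_of_S1 {g : Row} (hg : S1 g) : OutcomeL g := by
  obtain ⟨hadm, hy, hz, hc, hQ⟩ := hg
  obtain ⟨s, Y, Z, hs, hY, hZ, hv, h0, -, h2, -, -, h6, h7, -, -, -, hYZ⟩ := hadm.exists_state
  rw [h6, Multiset.card_eq_zero] at hy
  rw [h7, Multiset.card_eq_zero] at hz
  rw [h0, h2] at hc
  obtain ⟨hq, hr⟩ := hYZ hy hz
  rw [OutcomeL, winsFirst_left_iff, winsFirst_right_iff, not_not, hv, hy, hz, Multiset.map_zero,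
    Multiset.map_zero, Multiset.sum_zero, add_zero, add_zero]
  exact ⟨State.leftFirst_of_cond hs ⟨by simp only [State.numC]; omega, hr⟩,
    State.nonNeg_of_cond hs (.inl ⟨by simp only [State.numC]; omega, fun h => hQ (hq h)⟩)⟩

theorem outcomeL_of_S2 {g : Row} (hg : S2 g) : OutcomeL g := by
  obtain ⟨hadm, hy, hz, ha, hb, hc, he, hde⟩ := hg
  obtain ⟨s, Y, Z, hs, hY, hZ, hv, h0, h1, h2, h3, h4, h6, h7, hd, hh, hew, hYZ⟩ :=
    hadm.exists_state
  rw [h6, Multiset.card_eq_zero] at hy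
  rw [h7, Multiset.card_eq_zero] at hz
  rw [h0] at ha
  rw [h1] at hb
  rw [h2] at hc
  rw [h4] at he
  rw [h3, h4] at hde
  obtain ⟨-, hr⟩ := hYZ hy hz
  rw [OutcomeL, winsFirst_left_iff, winsFirst_right_iff, not_not, hv, hy, hz, Multiset.map_zero,
    Multiset.map_zero, Multiset.sum_zero, add_zero, add_zero]
  exact ⟨State.leftFirst_of_cond hs ⟨by simp only [State.numC]; omega, hr⟩,
    State.nonNeg_of_cond hs (.inr ⟨ha, hb, by omega, by omega, by omega⟩)⟩

/-! ### Alternating positions of even length -/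

theorem negPart_alt (c : Color) (n : ℕ) : negPart (alt c n) = alt c.opp n := by
  induction n generalizing c with
  | zero => rfl
  | succ n ih => exact congrArg (c.opp :: ·) (ih c.opp)

theorem neg_valA (t : ℕ) : -valA t = valA t := by
  rw [valA, ← val_negPart, ← val_reverse (a (2 * t)), a, negPart_alt, reverse_alt_even]

theorem leftFirst_valA {t : ℕ} (ht : 1 ≤ t) (ht' : t ≠ 3) : LeftFirst (valA t) := by
  have hs : State.Valid ⟨0, 0, 0, 0, 0, 0, 0, 0, 0⟩ := ⟨by simp, by simp, by simp⟩
  have hv : State.value ⟨0, 0, 0, 0, 0, 0, 0, 0, 0⟩ = 0 := by simp [State.value]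
  by_cases h : 4 ≤ t ∧ t ≠ 6
  · have := State.leftFirst_add_valA_of_le hs h.1 h.2 (by simp [State.numC])
    rwa [hv, zero_add] at this
  have h' : t = 1 ∨ t = 2 ∨ t = 6 := by omega
  rcases h' with rfl | rfl | rfl
  · have := State.leftFirst_of_cond (s := ⟨0, 0, 0, 0, 0, 0, 0, 0 + 1, 0⟩) ⟨hs.1, hs.2, hs.3⟩
      ⟨by simp [State.numC], by simp⟩
    rwa [State.value_d, hv, zero_add] at this
  · have := State.leftFirst_of_cond (s := ⟨0, 0, 0, 0, 0, 0, 0, 0, 0 + 1⟩) ⟨hs.1, hs.2, hs.3⟩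
      ⟨by simp [State.numC], by simp⟩
    rwa [State.value_h, hv, zero_add] at this
  · have := State.leftFirst_of_cond (s := ⟨0, 0, 0, 0, 0, 0, 0, 0 + 1, 0 + 1⟩)
      ⟨hs.1, hs.2, hs.3⟩ ⟨by simp [State.numC], by simp⟩
    rwa [State.value_d, State.value_h, hv, zero_add, ← State.valA_six] at this

theorem outcomeN_of_mem_setA {p : Part} (hp : p ∈ setA) (h6 : ¬ SamePart p (a 6)) :
    OutcomeN (p.map some) := by
  obtain ⟨q, ⟨t, ht, rfl⟩, hpq⟩ := hp
  have hv : value (parts (p.map some)) = valA t := by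
    rw [value_parts, blocks_map_some]
    exact hpq.val_eq
  have h := leftFirst_valA ht (by rintro rfl; exact h6 hpq)
  rw [OutcomeN, winsFirst_left_iff, winsFirst_right_iff, hv]
  refine ⟨h, ?_⟩
  rwa [LeftFirst, neg_valA] at h

end Clobber

open Clobber in
theorem mainTheorem1 :
    (∀ g : Row, S0 g → OutcomeL g ∨ OutcomeN g) ∧
    (∀ g : Row, S1 g ∨ S2 g → OutcomeL g) ∧
    (∀ p ∈ setA, ¬ SamePart p (a 6) → OutcomeN (p.map some)) :=
  ⟨fun _ => outcomeL_or_outcomeN_of_S0, fun _ hg => hg.elim outcomeL_of_S1 outcomeL_of_S2,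
    fun _ => outcomeN_of_mem_setA⟩
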